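/- Let $c,\omega,\delta\in\mathbb R$, $\gamma\in(\tfrac13,\tfrac12)$, $2\omega\notin\pi\mathbb Z$, let $\{q_n\}_{n\ge1}$ be a real sequence in $l^1$, and let $$b_n=\frac{c\sin(2\omega n+\delta)}{n^{\gamma}}+q_n,\qquad n\ge1.$$ Let $P_n$ be the orthonormal polynomials associated to the Jacobi matrix with diagonal entries $b_1,b_2,\dots$ and off-diagonal entries $1$, that is, $P_1(\lambda)=1$, $P_2(\lambda)=\lambda-b_1$ and $P_{n+1}(\lambda)=(\lambda-b_n)P_n(\lambda)-P_{n-1}(\lambda)$ for $n\ge2$. Let $\mathbb D$ be the open unit disc, $\mathbb T$ the unit circle, $$U=\mathbb C\setminus\{0,1,-1,e^{\pm i\omega},-e^{\pm i\omega},e^{\pm2i\omega},-e^{\pm2i\omega}\},\qquad \mu_2(z)=\frac{c^2z^2(1+z^2)e^{2i\omega}}{4(1-z^2)(z^2-e^{2i\omega})(1-z^2e^{2i\omega})}.$$ Then there is a function $F:\overline{\mathbb D}\cap U\to\mathbb C$ (the Jost function) with the following properties. - For every $z\in\mathbb D\setminus\{0\}$, as $n\to\infty$, $$P_n\left(z+\frac1z\right)=\frac{zF(z)}{1-z^2}\,\frac1{z^n}\exp\left(\frac{\mu_2(z)n^{1-2\gamma}}{1-2\gamma}\right)+o\left(\frac1{|z|^n}\exp\left(\frac{\operatorname{Re}\mu_2(z)\,n^{1-2\gamma}}{1-2\gamma}\right)\right).$$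 - For every $z\in\mathbb T\cap U$, as $n\to\infty$, $$P_n\left(z+\frac1z\right)=\frac{zF(z)}{1-z^2}\,\frac1{z^n}\exp\left(\frac{\mu_2(z)n^{1-2\gamma}}{1-2\gamma}\right)+\frac{z\overline{F(z)}}{z^2-1}\,z^n\exp\left(-\frac{\mu_2(z)n^{1-2\gamma}}{1-2\gamma}\right)+o(1).$$ - $F$ is analytic in $\mathbb D\setminus\{0\}$ and continuous on $\overline{\mathbb D}\cap U$ (in particular, on $\mathbb T\cap U$). -/

import Mathlib

open Filter Asymptotics Topology

/-- The orthonormal polynomials `P n` associated with the Jacobi matrix with off-diagonal entries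
`1` and diagonal entries `b 1, b 2, …`: `P 1 = 1`, `P 2 = X - b 1` and
`P (n + 1) = (X - b n) * P n - P (n - 1)` for `n ≥ 2`. The value `P 0 = 0` makes the recurrence
hold for `n = 1` as well; the sequence is indexed from `1`, and `b 0` is not used. -/
noncomputable def orthoPoly (b : ℕ → ℝ) : ℕ → Polynomial ℝ
  | 0 => 0
  | 1 => 1
  | n + 2 => (Polynomial.X - Polynomial.C (b (n + 1))) * orthoPoly b (n + 1) - orthoPoly b n

/-- The value `P n (lam)` at a complex point. -/
noncomputable def orthoPolyEval (b : ℕ → ℝ) (n : ℕ) (lam : ℂ) : ℂ :=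
  Polynomial.aeval lam (orthoPoly b n)

/-- The set `U`: the complex plane without
`0, 1, -1, e^{±iω}, -e^{±iω}, e^{±2iω}, -e^{±2iω}`. -/
def regularSet (ω : ℝ) : Set ℂ :=
  {0, 1, -1,
    Complex.exp (Complex.I * ω), Complex.exp (-(Complex.I * ω)),
    -Complex.exp (Complex.I * ω), -Complex.exp (-(Complex.I * ω)),
    Complex.exp (2 * Complex.I * ω), Complex.exp (-(2 * Complex.I * ω)),
    -Complex.exp (2 * Complex.I * ω), -Complex.exp (-(2 * Complex.I * ω))}ᶜ

/-- `μ₂(z) = c² z² (1 + z²) e^{2iω} / (4 (1 - z²) (z² - e^{2iω}) (1 - z² e^{2iω}))`. -/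
noncomputable def mu2 (c ω : ℝ) (z : ℂ) : ℂ :=
  (c : ℂ) ^ 2 * z ^ 2 * (1 + z ^ 2) * Complex.exp (2 * Complex.I * ω) /
    (4 * (1 - z ^ 2) * (z ^ 2 - Complex.exp (2 * Complex.I * ω)) *
      (1 - z ^ 2 * Complex.exp (2 * Complex.I * ω)))

/-- The exponent `μ₂(z) n^{1-2γ} / (1 - 2γ)`. -/
noncomputable def phaseExponent (c ω γ : ℝ) (z : ℂ) (n : ℕ) : ℂ :=
  mu2 c ω z * (((n : ℝ) ^ (1 - 2 * γ) : ℝ) : ℂ) / (1 - 2 * (γ : ℂ))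

/-!
Replace `n ^ (-γ)` by any amplitude `t n` in `l³` of bounded variation, and
`n ^ (1 - 2γ) / (1 - 2γ)` by a phase `s n` whose increments are `t n ^ 2` up to an
`l¹` error. In the recurrence for `z⁻ⁿ ψ n`, the term of order `t n` oscillates and is
removed by a bounded corrector; its product with the source has, at order `t n ^ 2`, an
oscillating part, removed by a second corrector, and a constant part, which is absorbed by the
factor `exp (-μ₂(z) s n)`. This gives an approximate solution of the form
`ψ n (z) = zⁿ exp (-μ₂(z) s n) (1 + o(1))` with an `l¹` relative defect,
and `ψ n (z⁻¹)` is a second one, independent of the first. A discrete Gronwall estimate for the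
Wronskians of `P n` with both bounds `P n (z + 1/z) zⁿ exp (-μ₂(z) s n)`, locally uniformly up
to the circle. Hence the Wronskian of `P n` with `ψ n` converges locally uniformly, and its
limit is the Jost function `F`. Inside the disc this is a contractive first-order recurrence for
`P n`; on the circle, where `P n` is real, it can be solved for `P n` together with its complex
conjugate.
-/

/-- The multiplier `e^{2iω}` of the oscillation `sin (2ωn + δ)` from one index to the next. -/
noncomputable def freq (ω : ℝ) : ℂ := Complex.exp (2 * Complex.I * ω)

section RegularSet

variable {c ω : ℝ} {z : ℂ}

lemma freq_ne_zero (ω : ℝ) : freq ω ≠ 0 := Complex.exp_ne_zero _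

lemma norm_freq (ω : ℝ) : ‖freq ω‖ = 1 := by
  rw [freq, show 2 * Complex.I * (ω : ℂ) = ((2 * ω : ℝ) : ℂ) * Complex.I by push_cast; ring]
  exact Complex.norm_exp_ofReal_mul_I _

lemma freq_sq_ne_one (hω : ∀ k : ℤ, 2 * ω ≠ Real.pi * k) : freq ω ^ 2 ≠ 1 := by
  rw [freq, ← Complex.exp_nat_mul, Ne, Complex.exp_eq_one_iff]
  rintro ⟨k, hk⟩
  have hωk : (2 * ω : ℂ) = Real.pi * k :=
    mul_left_cancel₀ (by simp : 2 * Complex.I ≠ 0) (by push_cast at hk; linear_combination hk)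
  exact hω k (by exact_mod_cast hωk)

lemma sq_eq_freq_zpow_iff {k : ℤ} : z ^ 2 = freq ω ^ k ↔
    z = Complex.exp (k * (Complex.I * ω)) ∨ z = -Complex.exp (k * (Complex.I * ω)) := by
  rw [freq, ← Complex.exp_int_mul, ← sq_eq_sq_iff_eq_or_eq_neg, ← Complex.exp_nat_mul]
  ring_nf

lemma mem_regularSet_iff : z ∈ regularSet ω ↔
    z ≠ 0 ∧ ∀ k ∈ Finset.Icc (-2 : ℤ) 2, z ^ 2 ≠ freq ω ^ k := by
  have hIcc : Finset.Icc (-2 : ℤ) 2 = {0, 1, -1, 2, -2} := by decide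
  simp only [hIcc, Finset.forall_mem_insert, Finset.mem_singleton, forall_eq, ne_eq,
    sq_eq_freq_zpow_iff, regularSet, Set.mem_compl_iff, Set.mem_insert_iff,
    Set.mem_singleton_iff]
  push_cast
  simp only [zero_mul, one_mul, neg_mul, Complex.exp_zero, ← mul_assoc]
  tauto

lemma ne_zero_of_mem_regularSet (hz : z ∈ regularSet ω) : z ≠ 0 := (mem_regularSet_iff.mp hz).1

lemma sq_ne_one_of_mem_regularSet (hz : z ∈ regularSet ω) : z ^ 2 ≠ 1 := by
  simpa using (mem_regularSet_iff.mp hz).2 0 (by decide)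

lemma inv_mem_regularSet (hz : z ∈ regularSet ω) : z⁻¹ ∈ regularSet ω := by
  rw [mem_regularSet_iff] at hz ⊢
  refine ⟨inv_ne_zero hz.1, fun k hk h => hz.2 (-k) ?_ ?_⟩
  · rw [Finset.mem_Icc] at hk ⊢; omega
  · rw [zpow_neg, ← h, inv_pow, inv_inv]

lemma mem_regularSet_of_norm_lt_one (h0 : z ≠ 0) (hz : ‖z‖ < 1) : z ∈ regularSet ω := by
  refine mem_regularSet_iff.mpr ⟨h0, fun k _ h => ?_⟩
  have hlt : ‖z ^ 2‖ < 1 := by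
    rw [norm_pow]; exact pow_lt_one₀ (norm_nonneg _) hz two_ne_zero
  simp [h, norm_zpow, norm_freq] at hlt

lemma isOpen_regularSet (ω : ℝ) : IsOpen (regularSet ω) :=
  (Set.Finite.isClosed (by simp)).isOpen_compl

lemma mu2_inv (hz : z ≠ 0) : mu2 c ω z⁻¹ = -mu2 c ω z := by
  have key (a : ℂ) : (c : ℂ) ^ 2 * z⁻¹ ^ 2 * (1 + z⁻¹ ^ 2) * a /
      (4 * (1 - z⁻¹ ^ 2) * (z⁻¹ ^ 2 - a) * (1 - z⁻¹ ^ 2 * a)) =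
      -((c : ℂ) ^ 2 * z ^ 2 * (1 + z ^ 2) * a /
        (4 * (1 - z ^ 2) * (z ^ 2 - a) * (1 - z ^ 2 * a))) := by
    rw [← mul_div_mul_right _ _ (pow_ne_zero 6 hz), ← neg_div_neg_eq (_ * z ^ 6), ← neg_div]
    congr 1 <;> (field_simp; ring)
  exact key _

lemma conj_mu2 : (starRingEnd ℂ) (mu2 c ω z) = mu2 c ω ((starRingEnd ℂ) z) := by
  have hconj : (starRingEnd ℂ) (freq ω) = (freq ω)⁻¹ :=
    (Complex.inv_eq_conj (norm_freq ω)).symm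
  have h0 := freq_ne_zero ω
  rw [mu2, mu2, ← freq]
  simp only [map_div₀, map_mul, map_pow, map_add, map_sub, map_one, map_ofNat, hconj,
    Complex.conj_ofReal]
  generalize freq ω = a at *
  rw [← mul_div_mul_right _ _ (pow_ne_zero 2 h0)]
  congr 1
  · field_simp
  · field_simp; ring

lemma re_mu2_of_norm_eq_one (hz : ‖z‖ = 1) : (mu2 c ω z).re = 0 := by
  have h : (starRingEnd ℂ) (mu2 c ω z) = -mu2 c ω z := by
    rw [conj_mu2, ← Complex.inv_eq_conj hz, mu2_inv (norm_ne_zero_iff.mp (by simp [hz]))]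
  have := congr_arg Complex.re h
  simp only [Complex.conj_re, Complex.neg_re] at this
  linarith

lemma analyticAt_mu2 (hz : z ∈ regularSet ω) : AnalyticAt ℂ (mu2 c ω) z := by
  have hplus : z ^ 2 ≠ freq ω := by simpa using (mem_regularSet_iff.mp hz).2 1 (by decide)
  have hminus : z ^ 2 ≠ (freq ω)⁻¹ := by simpa using (mem_regularSet_iff.mp hz).2 (-1) (by decide)
  refine AnalyticAt.div (by fun_prop) (by fun_prop) ?_
  refine mul_ne_zero (mul_ne_zero (mul_ne_zero (by norm_num) ?_) (sub_ne_zero.mpr hplus)) ?_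
  · exact sub_ne_zero.mpr (sq_ne_one_of_mem_regularSet hz).symm
  · exact sub_ne_zero.mpr fun h => hminus (eq_inv_of_mul_eq_one_left h.symm)

/- `Re μ₂` vanishes on the circle, so compare `w` with its radial projection `w / |w|`. -/
lemma exists_abs_re_mu2_le (hz : z ∈ regularSet ω) (hz1 : ‖z‖ = 1) :
    ∃ K : ℝ, ∀ᶠ w in 𝓝 z, |(mu2 c ω w).re| ≤ K * |1 - ‖w‖| := by
  obtain ⟨K, s, hs, hK⟩ :=
    ((analyticAt_mu2 (c := c) hz).contDiffAt (n := 1)).exists_lipschitzOnWith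
  have hproj : Tendsto (fun w : ℂ => w / ‖w‖) (𝓝 z) (𝓝 z) := by
    have h : ContinuousAt (fun w : ℂ => w / ‖w‖) z :=
      continuousAt_id.div (by fun_prop) (by simp [hz1])
    simpa [ContinuousAt, hz1] using h
  refine ⟨K, ?_⟩
  filter_upwards [hs, hproj hs, eventually_ne_nhds (ne_zero_of_mem_regularSet hz)]
    with w hw hw' hw0
  have hdist : ‖w - w / ‖w‖‖ = |1 - ‖w‖| := by
    have hn : (‖w‖ : ℂ) ≠ 0 := by simpa using hw0
    rw [show w - w / ‖w‖ = ((‖w‖ - 1 : ℝ) : ℂ) * (w / ‖w‖) by push_cast; field_simp, norm_mul,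
      Complex.norm_real, Real.norm_eq_abs, abs_sub_comm]
    simp [hw0]
  have hcircle : (mu2 c ω (w / ‖w‖)).re = 0 := re_mu2_of_norm_eq_one (by simp [hw0])
  calc |(mu2 c ω w).re| = |(mu2 c ω w - mu2 c ω (w / ‖w‖)).re| := by
        rw [Complex.sub_re, hcircle, sub_zero]
    _ ≤ ‖mu2 c ω w - mu2 c ω (w / ‖w‖)‖ := Complex.abs_re_le_norm _
    _ ≤ K * |1 - ‖w‖| := hdist ▸ hK.norm_sub_le hw hw'

end RegularSet

/-- The error committed at the index `n` by the second-order ansatz for the Jacobi matrix with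
diagonal `b n = c t_n sin (2ωn + δ) + q_n` and phase `exp (-μ₂ s_n)`: the `l¹` perturbation, the
third-order terms, the variation of the amplitude, and the deviation of the phase increments from
`t_n²`. Its summability is the standing assumption on the data. -/
noncomputable def errorTerm (t s q : ℕ → ℝ) (n : ℕ) : ℝ :=
  |q n| + |t n| ^ 3 + |t (n + 1) - t n| + |s (n + 1) - s n - t n ^ 2|

section ErrorTerm

variable {t s q : ℕ → ℝ}

lemma abs_perturbation_le_errorTerm (n : ℕ) : |q n| ≤ errorTerm t s q n := by
  unfold errorTerm
  linarith [pow_nonneg (abs_nonneg (t n)) 3, abs_nonneg (t (n + 1) - t n),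
    abs_nonneg (s (n + 1) - s n - t n ^ 2)]

lemma abs_amplitude_cube_le_errorTerm (n : ℕ) : |t n| ^ 3 ≤ errorTerm t s q n := by
  unfold errorTerm
  linarith [abs_nonneg (q n), abs_nonneg (t (n + 1) - t n),
    abs_nonneg (s (n + 1) - s n - t n ^ 2)]

lemma abs_amplitude_step_le_errorTerm (n : ℕ) : |t (n + 1) - t n| ≤ errorTerm t s q n := by
  unfold errorTerm
  linarith [abs_nonneg (q n), pow_nonneg (abs_nonneg (t n)) 3,
    abs_nonneg (s (n + 1) - s n - t n ^ 2)]

lemma abs_phase_error_le_errorTerm (n : ℕ) :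
    |s (n + 1) - s n - t n ^ 2| ≤ errorTerm t s q n := by
  unfold errorTerm
  linarith [abs_nonneg (q n), pow_nonneg (abs_nonneg (t n)) 3, abs_nonneg (t (n + 1) - t n)]

lemma errorTerm_nonneg (n : ℕ) : 0 ≤ errorTerm t s q n :=
  (abs_nonneg _).trans (abs_perturbation_le_errorTerm n)

lemma tendsto_amplitude (he : Summable (errorTerm t s q)) : Tendsto t atTop (𝓝 0) := by
  have hcube : Tendsto (fun n => |t n| ^ 3) atTop (𝓝 0) :=
    squeeze_zero (fun n => by positivity) abs_amplitude_cube_le_errorTerm he.tendsto_atTop_zero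
  have hroot := hcube.rpow_const (p := ((3 : ℕ) : ℝ)⁻¹) (Or.inr (by norm_num))
  rw [Real.zero_rpow (by norm_num)] at hroot
  exact (tendsto_zero_iff_abs_tendsto_zero t).mpr
    (hroot.congr fun n => Real.pow_rpow_inv_natCast (abs_nonneg (t n)) three_ne_zero)

lemma tendsto_phase_error (he : Summable (errorTerm t s q)) :
    Tendsto (fun n => s (n + 1) - s n - t n ^ 2) atTop (𝓝 0) :=
  squeeze_zero_norm abs_phase_error_le_errorTerm he.tendsto_atTop_zero

lemma tendsto_phase_step (he : Summable (errorTerm t s q)) :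
    Tendsto (fun n => s (n + 1) - s n) atTop (𝓝 0) := by
  simpa using (tendsto_phase_error he).add ((tendsto_amplitude he).pow 2)

lemma isBigO_phase_step_sq (he : Summable (errorTerm t s q)) :
    (fun n => (s (n + 1) - s n) ^ 2) =O[atTop] errorTerm t s q := by
  refine IsBigO.of_bound 4 ?_
  filter_upwards [(tendsto_amplitude he).abs.eventually_le_const (by norm_num : |(0 : ℝ)| < 1),
    (tendsto_phase_error he).abs.eventually_le_const (by norm_num : |(0 : ℝ)| < 1)]
    with n ht hd
  rw [Real.norm_of_nonneg (sq_nonneg _), Real.norm_of_nonneg (errorTerm_nonneg n)]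
  set d := s (n + 1) - s n - t n ^ 2 with hd_def
  have hd2 : d ^ 2 ≤ errorTerm t s q n := by
    refine le_trans ?_ (abs_phase_error_le_errorTerm n)
    rw [← sq_abs]
    exact pow_le_of_le_one (abs_nonneg d) hd two_ne_zero
  have ht4 : t n ^ 4 ≤ errorTerm t s q n := by
    refine le_trans ?_ (abs_amplitude_cube_le_errorTerm n)
    rw [← (by decide : Even 4).pow_abs]
    exact pow_le_pow_of_le_one (abs_nonneg _) ht (by norm_num)
  calc (s (n + 1) - s n) ^ 2 = (d + t n ^ 2) ^ 2 := by rw [hd_def]; ring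
    _ ≤ 2 * (d ^ 2 + (t n ^ 2) ^ 2) := add_sq_le
    _ ≤ 4 * errorTerm t s q n := by linarith [pow_mul (t n) 2 2]

end ErrorTerm

/-- The error of the second-order expansion `1 + m t_n²` of `exp (m (s_{n+1} - s_n))`. -/
noncomputable def phaseError (m : ℂ) (t s : ℕ → ℝ) (n : ℕ) : ℂ :=
  Complex.exp (m * ((s (n + 1) - s n : ℝ) : ℂ)) - 1 - m * (t n : ℂ) ^ 2

section ContinuousCoefficient

variable {ι : Type*} {z₀ : ℂ} {m : ℂ → ℂ}

lemma isBigO_one_of_continuousAt (l : Filter ι) (hm : ContinuousAt m z₀) :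
    (fun p : ι × ℂ => m p.2) =O[l ×ˢ 𝓝 z₀] fun _ => (1 : ℝ) :=
  (hm.tendsto.comp tendsto_snd).isBigO_one ℝ

lemma isBigO_mul_of_isBigO_one {l : Filter ι} {f g : ι → ℂ} {ρ : ι → ℝ} (hf : f =O[l] ρ)
    (hg : g =O[l] fun _ => (1 : ℝ)) : (fun i => f i * g i) =O[l] ρ :=
  (hf.mul hg).congr_right fun i => mul_one (ρ i)

lemma isBigO_phaseError {t s q : ℕ → ℝ} (he : Summable (errorTerm t s q))
    (hm : ContinuousAt m z₀) :
    (fun p : ℕ × ℂ => phaseError (m p.2) t s p.1) =O[atTop ×ˢ 𝓝 z₀]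
      fun p => errorTerm t s q p.1 := by
  set x : ℕ × ℂ → ℂ := fun p => m p.2 * ((s (p.1 + 1) - s p.1 : ℝ) : ℂ) with hx
  have hm1 := isBigO_one_of_continuousAt (atTop : Filter ℕ) hm
  have hx0 : Tendsto x (atTop ×ˢ 𝓝 z₀) (𝓝 0) := by
    simpa only [hx, Complex.ofReal_zero, mul_zero, Function.comp_apply] using
      (hm.tendsto.comp tendsto_snd).mul
        ((Complex.continuous_ofReal.tendsto 0).comp ((tendsto_phase_step he).comp tendsto_fst))
  have hexp : (fun p => Complex.exp (x p) - 1 - x p) =O[atTop ×ˢ 𝓝 z₀]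
      fun p => errorTerm t s q p.1 := by
    have hquad : (fun p => Complex.exp (x p) - 1 - x p) =O[atTop ×ˢ 𝓝 z₀] fun p => x p ^ 2 := by
      simpa [Function.comp_def, Finset.sum_range_succ, sub_sub] using
        (Complex.exp_sub_sum_range_isBigO_pow 2).comp_tendsto hx0
    have hstep : (fun p : ℕ × ℂ => (((s (p.1 + 1) - s p.1) ^ 2 : ℝ) : ℂ)) =O[atTop ×ˢ 𝓝 z₀]
        fun p => errorTerm t s q p.1 :=
      Complex.isBigO_ofReal_left.mpr ((isBigO_phase_step_sq he).comp_tendsto tendsto_fst)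
    refine hquad.trans ((isBigO_mul_of_isBigO_one hstep
      (isBigO_one_of_continuousAt atTop (hm.pow 2))).congr_left fun p => ?_)
    simp only [hx, Pi.pow_apply, Complex.ofReal_pow]
    ring
  have hlin : (fun p : ℕ × ℂ => ((s (p.1 + 1) - s p.1 - t p.1 ^ 2 : ℝ) : ℂ) * m p.2)
      =O[atTop ×ˢ 𝓝 z₀] fun p => errorTerm t s q p.1 :=
    isBigO_mul_of_isBigO_one (.of_norm_le fun p => by
      rw [Complex.norm_real]; exact abs_phase_error_le_errorTerm p.1) hm1
  refine (hexp.add hlin).congr_left fun p => ?_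
  simp only [hx, phaseError]
  push_cast
  ring

end ContinuousCoefficient

/-- The change of the free symbol `z + z⁻¹` when `z` is rotated to `z a`. -/
noncomputable def symbolDiff (a z : ℂ) : ℂ := z * a + (z * a)⁻¹ - (z + z⁻¹)

/-- The response at `n` of the free Jacobi operator, conjugated by `z ^ n`, to the source `B aⁿ`.
For `a` with `symbolDiff a z = 0` the division gives the junk value `0`. -/
noncomputable def response (B a z : ℂ) (n : ℕ) : ℂ := -(B / symbolDiff a z) * a ^ n

/-- The amplitude of the positive-frequency part of `c sin (2ωn + δ)`; that of the
negative-frequency part is `amp (-c) (-δ)`. -/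
noncomputable def amp (c δ : ℝ) : ℂ := c / (2 * Complex.I) * Complex.exp (Complex.I * δ)

/-- The coefficient of `t_n` in the ansatz. The negative frequency enters through the symmetry
`(c, ω, δ) ↦ (-c, -ω, -δ)` of the sine. -/
noncomputable def firstCorr (c ω δ : ℝ) (z : ℂ) (n : ℕ) : ℂ :=
  response (amp c δ) (freq ω) z n + response (amp (-c) (-δ)) (freq (-ω)) z n

/-- The coefficient of `t_n²` in the ansatz: the response to the nonresonant part of the product of
the source with `firstCorr`. -/
noncomputable def secondCorr (c ω δ : ℝ) (z : ℂ) (n : ℕ) : ℂ :=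
  response (amp c δ * response (amp c δ) (freq ω) z 0) (freq ω ^ 2) z n +
    response (amp (-c) (-δ) * response (amp (-c) (-δ)) (freq (-ω)) z 0) (freq (-ω) ^ 2) z n

section Correctors

variable {c ω δ : ℝ} {a z z₀ : ℂ}

lemma symbolDiff_eq_mul (ha : a ≠ 0) : symbolDiff a z = (a - 1) * (z - (z * a)⁻¹) := by
  rw [symbolDiff]; field_simp; ring

lemma symbolDiff_ne_zero (ha0 : a ≠ 0) (ha1 : a ≠ 1) (hz : z ≠ 0) (hza : z ^ 2 ≠ a⁻¹) :
    symbolDiff a z ≠ 0 := by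
  rw [symbolDiff_eq_mul ha0]
  refine mul_ne_zero (sub_ne_zero.mpr ha1) fun h => hza ?_
  rw [sub_eq_zero, ← mul_eq_one_iff_eq_inv₀ (mul_ne_zero hz ha0)] at h
  exact eq_inv_of_mul_eq_one_left (by linear_combination h)

lemma freq_neg (ω : ℝ) : freq (-ω) = (freq ω)⁻¹ := by
  rw [freq, freq, ← Complex.exp_neg]; push_cast; ring_nf

lemma freq_neg_sq_ne_one (hω : freq ω ^ 2 ≠ 1) : freq (-ω) ^ 2 ≠ 1 := by
  simpa [freq_neg] using hω

lemma mem_regularSet_neg_iff : z ∈ regularSet (-ω) ↔ z ∈ regularSet ω := by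
  have key {ω : ℝ} (hz : z ∈ regularSet ω) : z ∈ regularSet (-ω) := by
    rw [mem_regularSet_iff] at hz ⊢
    refine ⟨hz.1, fun k hk => ?_⟩
    rw [freq_neg, inv_zpow']
    exact hz.2 (-k) (by rw [Finset.mem_Icc] at hk ⊢; omega)
  exact ⟨fun hz => neg_neg ω ▸ key hz, key⟩

lemma symbolDiff_freq_ne_zero (hω : freq ω ^ 2 ≠ 1) (hz : z ∈ regularSet ω) :
    symbolDiff (freq ω) z ≠ 0 :=
  symbolDiff_ne_zero (freq_ne_zero ω) (fun h => hω (by rw [h, one_pow]))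
    (ne_zero_of_mem_regularSet hz) (by simpa using (mem_regularSet_iff.mp hz).2 (-1) (by decide))

lemma symbolDiff_freq_sq_ne_zero (hω : freq ω ^ 2 ≠ 1) (hz : z ∈ regularSet ω) :
    symbolDiff (freq ω ^ 2) z ≠ 0 := by
  refine symbolDiff_ne_zero (pow_ne_zero 2 (freq_ne_zero ω)) hω (ne_zero_of_mem_regularSet hz) ?_
  have h := (mem_regularSet_iff.mp hz).2 (-2) (by decide)
  rwa [zpow_neg] at h

lemma analyticAt_symbolDiff (ha : a ≠ 0) (hz : z ≠ 0) : AnalyticAt ℂ (symbolDiff a) z := by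
  unfold symbolDiff
  fun_prop (disch := simp [ha, hz])

lemma analyticAt_response {B : ℂ → ℂ} (hB : AnalyticAt ℂ B z) (ha : a ≠ 0) (hz : z ≠ 0)
    (h : symbolDiff a z ≠ 0) (n : ℕ) : AnalyticAt ℂ (fun z => response (B z) a z n) z :=
  (hB.div (analyticAt_symbolDiff ha hz) h).neg.mul analyticAt_const

lemma analyticAt_response_freq (A : ℂ) (hω : freq ω ^ 2 ≠ 1) (hz : z ∈ regularSet ω) (n : ℕ) :
    AnalyticAt ℂ (fun z => response A (freq ω) z n) z :=
  analyticAt_response analyticAt_const (freq_ne_zero ω) (ne_zero_of_mem_regularSet hz)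
    (symbolDiff_freq_ne_zero hω hz) n

lemma analyticAt_response_freq_sq (A : ℂ) (hω : freq ω ^ 2 ≠ 1) (hz : z ∈ regularSet ω) (n : ℕ) :
    AnalyticAt ℂ (fun z => response (A * response A (freq ω) z 0) (freq ω ^ 2) z n) z :=
  analyticAt_response (analyticAt_const.mul (analyticAt_response_freq A hω hz 0))
    (pow_ne_zero 2 (freq_ne_zero ω)) (ne_zero_of_mem_regularSet hz)
    (symbolDiff_freq_sq_ne_zero hω hz) n

lemma analyticAt_firstCorr (c δ : ℝ) (hω : freq ω ^ 2 ≠ 1) (hz : z ∈ regularSet ω) (n : ℕ) :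
    AnalyticAt ℂ (fun z => firstCorr c ω δ z n) z :=
  (analyticAt_response_freq _ hω hz n).add (analyticAt_response_freq _ (freq_neg_sq_ne_one hω)
    (mem_regularSet_neg_iff.mpr hz) n)

lemma analyticAt_secondCorr (c δ : ℝ) (hω : freq ω ^ 2 ≠ 1) (hz : z ∈ regularSet ω) (n : ℕ) :
    AnalyticAt ℂ (fun z => secondCorr c ω δ z n) z :=
  (analyticAt_response_freq_sq _ hω hz n).add (analyticAt_response_freq_sq _
    (freq_neg_sq_ne_one hω) (mem_regularSet_neg_iff.mpr hz) n)

lemma response_recurrence (B : ℂ) (ha : a ≠ 0) (hz : z ≠ 0) (h : symbolDiff a z ≠ 0) (n : ℕ) :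
    z * response B a z (n + 2) + z⁻¹ * response B a z n - (z + z⁻¹) * response B a z (n + 1) =
      -(B * a ^ (n + 1)) := by
  have hmode : z * a ^ 2 + z⁻¹ - (z + z⁻¹) * a = a * symbolDiff a z := by
    rw [symbolDiff]; field_simp
  calc _ = -(B / symbolDiff a z) * a ^ n * (z * a ^ 2 + z⁻¹ - (z + z⁻¹) * a) := by
        simp only [response]; ring
    _ = -(B * a ^ (n + 1)) := by rw [hmode]; field_simp; ring

lemma isBigO_response {B : ℂ → ℂ} (hB : ContinuousAt B z₀) (ha : ‖a‖ = 1) (hz : z₀ ≠ 0)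
    (h : symbolDiff a z₀ ≠ 0) (k : ℕ) :
    (fun p : ℕ × ℂ => response (B p.2) a p.2 (p.1 + k)) =O[atTop ×ˢ 𝓝 z₀] fun _ => (1 : ℝ) := by
  have ha0 : a ≠ 0 := norm_ne_zero_iff.mp (by simp [ha])
  refine isBigO_mul_of_isBigO_one
    (isBigO_one_of_continuousAt atTop (hB.div (analyticAt_symbolDiff ha0 hz).continuousAt h).neg) ?_
  exact .of_norm_le fun p => by simp [ha]

lemma amp_mul_amp_neg : amp c δ * amp (-c) (-δ) = (c : ℂ) ^ 2 / 4 := by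
  have hexp : Complex.exp (Complex.I * δ) * Complex.exp (Complex.I * (-δ : ℝ)) = 1 := by
    rw [← Complex.exp_add]; simp
  calc amp c δ * amp (-c) (-δ)
      = -(c / (2 * Complex.I)) ^ 2 *
          (Complex.exp (Complex.I * δ) * Complex.exp (Complex.I * (-δ : ℝ))) := by
        rw [amp, amp]; push_cast; ring
    _ = (c : ℂ) ^ 2 / 4 := by rw [hexp, div_pow, mul_pow, Complex.I_sq]; ring

lemma ofReal_mul_sin_eq (c ω δ : ℝ) (n : ℕ) : ((c * Real.sin (2 * ω * n + δ) : ℝ) : ℂ) =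
    amp c δ * freq ω ^ n + amp (-c) (-δ) * freq (-ω) ^ n := by
  have hmode (c ω δ : ℝ) : amp c δ * freq ω ^ n =
      c / (2 * Complex.I) * Complex.exp ((2 * ω * n + δ) * Complex.I) := by
    rw [amp, freq, mul_assoc, ← Complex.exp_nat_mul, ← Complex.exp_add]
    ring_nf
  rw [hmode, hmode]
  push_cast
  rw [Complex.sin, show (2 * -(ω : ℂ) * n + -δ) * Complex.I = -(2 * ω * n + δ) * Complex.I by ring]
  field_simp
  rw [Complex.I_sq]
  ring

lemma mu2_mul_inv_sub_eq (hω : freq ω ^ 2 ≠ 1) (hz : z ∈ regularSet ω) :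
    mu2 c ω z * (z⁻¹ - z) =
      (c : ℂ) ^ 2 / 4 * ((symbolDiff (freq ω) z)⁻¹ + (symbolDiff (freq (-ω)) z)⁻¹) := by
  have h0 := ne_zero_of_mem_regularSet hz
  have ha := freq_ne_zero ω
  have ha1 : freq ω - 1 ≠ 0 := fun h => hω (by rw [sub_eq_zero.mp h, one_pow])
  have hz1 : 1 - z ^ 2 ≠ 0 := sub_ne_zero.mpr (sq_ne_one_of_mem_regularSet hz).symm
  have hplus : symbolDiff (freq ω) z = -((freq ω - 1) * (1 - z ^ 2 * freq ω)) / (z * freq ω) := by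
    rw [symbolDiff_eq_mul ha]; field_simp; ring
  have hminus : symbolDiff (freq (-ω)) z = -((freq ω - 1) * (z ^ 2 - freq ω)) / (z * freq ω) := by
    rw [freq_neg, symbolDiff_eq_mul (inv_ne_zero ha)]; field_simp; ring
  have hplus0 := symbolDiff_freq_ne_zero hω hz
  have hminus0 := symbolDiff_freq_ne_zero (freq_neg_sq_ne_one hω) (mem_regularSet_neg_iff.mpr hz)
  rw [hplus] at hplus0 ⊢
  rw [hminus] at hminus0 ⊢
  rw [mu2, ← freq]
  have hd1 : 1 - z ^ 2 * freq ω ≠ 0 := fun h => hplus0 (by simp [h])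
  have hd2 : z ^ 2 - freq ω ≠ 0 := fun h => hminus0 (by simp [h])
  generalize freq ω = a at *
  field_simp
  ring

lemma firstCorr_recurrence (hω : freq ω ^ 2 ≠ 1) (hz : z ∈ regularSet ω) (n : ℕ) :
    z * firstCorr c ω δ z (n + 2) + z⁻¹ * firstCorr c ω δ z n -
        (z + z⁻¹) * firstCorr c ω δ z (n + 1) =
      -((c * Real.sin (2 * ω * (n + 1 : ℕ) + δ) : ℝ) : ℂ) := by
  have h0 := ne_zero_of_mem_regularSet hz
  have hplus := response_recurrence (amp c δ) (freq_ne_zero ω) h0 (symbolDiff_freq_ne_zero hω hz) n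
  have hminus := response_recurrence (amp (-c) (-δ)) (freq_ne_zero (-ω)) h0
    (symbolDiff_freq_ne_zero (freq_neg_sq_ne_one hω) (mem_regularSet_neg_iff.mpr hz)) n
  rw [ofReal_mul_sin_eq]
  simp only [firstCorr]
  linear_combination hplus + hminus

/- The source times `firstCorr` has the two oscillating parts that `secondCorr` responds to and a
constant part; by `mu2_mul_inv_sub_eq`, `μ₂` is defined so as to absorb the latter. -/
lemma secondCorr_recurrence (hω : freq ω ^ 2 ≠ 1) (hz : z ∈ regularSet ω) (n : ℕ) :
    z * secondCorr c ω δ z (n + 2) + z⁻¹ * secondCorr c ω δ z n -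
        (z + z⁻¹) * secondCorr c ω δ z (n + 1) =
      -(((c * Real.sin (2 * ω * (n + 1 : ℕ) + δ) : ℝ) : ℂ) * firstCorr c ω δ z (n + 1)) -
        mu2 c ω z * (z⁻¹ - z) := by
  have h0 := ne_zero_of_mem_regularSet hz
  have hω' := freq_neg_sq_ne_one hω
  have hz' := mem_regularSet_neg_iff.mpr hz
  have hplus := response_recurrence (amp c δ * response (amp c δ) (freq ω) z 0)
    (pow_ne_zero 2 (freq_ne_zero ω)) h0 (symbolDiff_freq_sq_ne_zero hω hz) n
  have hminus := response_recurrence (amp (-c) (-δ) * response (amp (-c) (-δ)) (freq (-ω)) z 0)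
    (pow_ne_zero 2 (freq_ne_zero (-ω))) h0 (symbolDiff_freq_sq_ne_zero hω' hz') n
  have hcancel : freq ω ^ (n + 1) * freq (-ω) ^ (n + 1) = 1 := by
    rw [← mul_pow, freq_neg, mul_inv_cancel₀ (freq_ne_zero ω), one_pow]
  rw [ofReal_mul_sin_eq, mu2_mul_inv_sub_eq hω hz, ← amp_mul_amp_neg (δ := δ)]
  simp only [secondCorr, firstCorr]
  simp only [response, pow_zero, mul_one] at hplus hminus ⊢
  simp only [div_eq_mul_inv] at hplus hminus ⊢
  linear_combination hplus + hminus - amp c δ * amp (-c) (-δ) *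
    ((symbolDiff (freq ω) z)⁻¹ + (symbolDiff (freq (-ω)) z)⁻¹) * hcancel

lemma isBigO_firstCorr (c δ : ℝ) (hω : freq ω ^ 2 ≠ 1) (hz : z₀ ∈ regularSet ω) (k : ℕ) :
    (fun p : ℕ × ℂ => firstCorr c ω δ p.2 (p.1 + k)) =O[atTop ×ˢ 𝓝 z₀] fun _ => (1 : ℝ) := by
  have h0 := ne_zero_of_mem_regularSet hz
  exact (isBigO_response continuousAt_const (norm_freq ω) h0 (symbolDiff_freq_ne_zero hω hz) k).add
    (isBigO_response continuousAt_const (norm_freq (-ω)) h0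
      (symbolDiff_freq_ne_zero (freq_neg_sq_ne_one hω) (mem_regularSet_neg_iff.mpr hz)) k)

lemma isBigO_response_freq_sq (A : ℂ) (hω : freq ω ^ 2 ≠ 1) (hz : z₀ ∈ regularSet ω) (k : ℕ) :
    (fun p : ℕ × ℂ => response (A * response A (freq ω) p.2 0) (freq ω ^ 2) p.2 (p.1 + k))
      =O[atTop ×ˢ 𝓝 z₀] fun _ => (1 : ℝ) :=
  isBigO_response (B := fun z => A * response A (freq ω) z 0)
    (analyticAt_const.mul (analyticAt_response_freq A hω hz 0)).continuousAt
    (by rw [norm_pow, norm_freq, one_pow]) (ne_zero_of_mem_regularSet hz)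
    (symbolDiff_freq_sq_ne_zero hω hz) k

lemma isBigO_secondCorr (c δ : ℝ) (hω : freq ω ^ 2 ≠ 1) (hz : z₀ ∈ regularSet ω) (k : ℕ) :
    (fun p : ℕ × ℂ => secondCorr c ω δ p.2 (p.1 + k)) =O[atTop ×ˢ 𝓝 z₀] fun _ => (1 : ℝ) :=
  (isBigO_response_freq_sq (amp c δ) hω hz k).add (isBigO_response_freq_sq (amp (-c) (-δ))
    (freq_neg_sq_ne_one hω) (mem_regularSet_neg_iff.mpr hz) k)

end Correctors

/-- The correction factor `u` of the ansatz `θ (1 + u)`, up to second order in the amplitude. -/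
noncomputable def jostCorr (c ω δ : ℝ) (t : ℕ → ℝ) (n : ℕ) (z : ℂ) : ℂ :=
  t n * firstCorr c ω δ z n + t n ^ 2 * secondCorr c ω δ z n

/-- The leading factor `θ_n(z) = zⁿ exp (-μ₂(z) s_n)` of the ansatz. -/
noncomputable def jostPhase (c ω : ℝ) (s : ℕ → ℝ) (n : ℕ) (z : ℂ) : ℂ :=
  z ^ n * Complex.exp (-(mu2 c ω z * s n))

/-- The approximate solution `ψ = θ (1 + u)` of the Jacobi recurrence that decays for `|z| < 1`;
its value at `z⁻¹` is the approximate solution that grows. -/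
noncomputable def jostApprox (c ω δ : ℝ) (t s : ℕ → ℝ) (n : ℕ) (z : ℂ) : ℂ :=
  jostPhase c ω s n z * (1 + jostCorr c ω δ t n z)

/-- The failure of `v` to solve the three-term recurrence `v_{n+2} = lam_n v_{n+1} - v_n`. -/
def recurrenceDefect {R : Type*} [CommRing R] (lam v : ℕ → R) (n : ℕ) : R :=
  v (n + 2) + v n - lam n * v (n + 1)

/-- The coefficients of the Jacobi recurrence at the spectral parameter `z + z⁻¹`, in the form
required by `recurrenceDefect`. -/
noncomputable def spectralCoeff (b : ℕ → ℝ) (z : ℂ) (n : ℕ) : ℂ := z + z⁻¹ - b (n + 1)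

/-- The bound for the defect at the index `n`, which involves the data at `n` and `n + 1`. -/
noncomputable def errorBound (t s q : ℕ → ℝ) (n : ℕ) : ℝ :=
  errorTerm t s q n + errorTerm t s q (n + 1)

section Ansatz

variable {c ω δ : ℝ} {t s q b : ℕ → ℝ} {n : ℕ} {z z₀ : ℂ}

lemma jostPhase_ne_zero (hz : z ≠ 0) : jostPhase c ω s n z ≠ 0 :=
  mul_ne_zero (pow_ne_zero _ hz) (Complex.exp_ne_zero _)

lemma jostPhase_inv (hz : z ≠ 0) : jostPhase c ω s n z⁻¹ = (jostPhase c ω s n z)⁻¹ := by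
  rw [jostPhase, jostPhase, mu2_inv hz, mul_inv, inv_pow, ← Complex.exp_neg, neg_mul]

lemma jostPhase_succ : jostPhase c ω s (n + 1) z =
    jostPhase c ω s n z * (z * Complex.exp (-mu2 c ω z * ((s (n + 1) - s n : ℝ) : ℂ))) := by
  have hexp : -(mu2 c ω z * s (n + 1)) =
      -(mu2 c ω z * s n) + -mu2 c ω z * ((s (n + 1) - s n : ℝ) : ℂ) := by push_cast; ring
  rw [jostPhase, jostPhase, hexp, Complex.exp_add]
  ring

lemma jostPhase_eq_succ_mul (hz : z ≠ 0) : jostPhase c ω s n z =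
    jostPhase c ω s (n + 1) z *
      (z⁻¹ * Complex.exp (mu2 c ω z * ((s (n + 1) - s n : ℝ) : ℂ))) := by
  rw [jostPhase_succ, neg_mul, Complex.exp_neg]
  have := Complex.exp_ne_zero (mu2 c ω z * ((s (n + 1) - s n : ℝ) : ℂ))
  field_simp

lemma errorBound_nonneg (n : ℕ) : 0 ≤ errorBound t s q n :=
  add_nonneg (errorTerm_nonneg n) (errorTerm_nonneg (n + 1))

lemma summable_errorBound (he : Summable (errorTerm t s q)) : Summable (errorBound t s q) :=
  he.add ((summable_nat_add_iff 1).mpr he)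

lemma isBigO_errorBound {f : ℕ × ℂ → ℂ} {l : Filter ℂ}
    (hf : f =O[atTop ×ˢ l] fun p => errorTerm t s q p.1) :
    f =O[atTop ×ˢ l] fun p => errorBound t s q p.1 :=
  hf.trans <| .of_norm_le fun p => by
    rw [Real.norm_of_nonneg (errorTerm_nonneg _)]
    exact le_add_of_nonneg_right (errorTerm_nonneg _)

lemma isBigO_errorBound_succ {f : ℕ × ℂ → ℂ} {l : Filter ℂ}
    (hf : f =O[atTop ×ˢ l] fun p => errorTerm t s q p.1) :
    (fun p => f (p.1 + 1, p.2)) =O[atTop ×ˢ l] fun p => errorBound t s q p.1 :=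
  (hf.comp_tendsto ((tendsto_add_atTop_nat 1).prodMap tendsto_id)).trans <| .of_norm_le fun p => by
    rw [Function.comp_apply, Real.norm_of_nonneg (errorTerm_nonneg _)]
    exact le_add_of_nonneg_left (errorTerm_nonneg _)

/- The corrector equations cancel the terms of orders `t` and `t²`; `d₂` and `d₀` stand for the
errors in the expansions of the phase ratios. -/
lemma ansatz_defect_expansion {z w σ q μ t₁ t₂ t₀ g₁ g₂ g₀ h₁ h₂ h₀ d₂ d₀ : ℂ}
    (hg : z * g₂ + w * g₀ - (z + w) * g₁ = -σ)
    (hh : z * h₂ + w * h₀ - (z + w) * h₁ = -(σ * g₁) - μ * (w - z)) :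
    z * (1 - μ * t₁ ^ 2 + d₂) * (1 + (t₂ * g₂ + t₂ ^ 2 * h₂)) +
        w * (1 + μ * t₀ ^ 2 + d₀) * (1 + (t₀ * g₀ + t₀ ^ 2 * h₀)) -
        (z + w - (t₁ * σ + q)) * (1 + (t₁ * g₁ + t₁ ^ 2 * h₁)) =
      d₂ * (z * (1 + (t₂ * g₂ + t₂ ^ 2 * h₂))) + d₀ * (w * (1 + (t₀ * g₀ + t₀ ^ 2 * h₀))) +
        (t₂ - t₁) * (z * (1 - μ * t₁ ^ 2) * (g₂ + (t₂ + t₁) * h₂)) -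
        (t₁ - t₀) * (w * (μ * (t₀ + t₁) * (1 + (t₀ * g₀ + t₀ ^ 2 * h₀)) +
          (1 + μ * t₁ ^ 2) * (g₀ + (t₀ + t₁) * h₀))) +
        q * (1 + (t₁ * g₁ + t₁ ^ 2 * h₁)) +
        t₁ ^ 3 * (μ * (w * (g₀ + t₁ * h₀) - z * (g₂ + t₁ * h₂)) + σ * h₁) := by
  linear_combination t₁ * hg + t₁ ^ 2 * hh

lemma recurrenceDefect_jostApprox (hz : z ≠ 0) :
    recurrenceDefect (spectralCoeff b z) (fun n => jostApprox c ω δ t s n z) n =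
      jostPhase c ω s (n + 1) z *
        (z * Complex.exp (-mu2 c ω z * ((s (n + 2) - s (n + 1) : ℝ) : ℂ)) *
            (1 + jostCorr c ω δ t (n + 2) z) +
          z⁻¹ * Complex.exp (mu2 c ω z * ((s (n + 1) - s n : ℝ) : ℂ)) *
            (1 + jostCorr c ω δ t n z) -
          (z + z⁻¹ - b (n + 1)) * (1 + jostCorr c ω δ t (n + 1) z)) := by
  rw [recurrenceDefect, spectralCoeff, jostApprox, jostApprox, jostApprox, jostPhase_succ,
    jostPhase_eq_succ_mul (n := n) hz]
  ring

lemma recurrenceDefect_jostApprox_eq_errorTerms (hω : freq ω ^ 2 ≠ 1)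
    (hb : ∀ n, b (n + 1) = c * t (n + 1) * Real.sin (2 * ω * (n + 1 : ℕ) + δ) + q (n + 1))
    (hz : z ∈ regularSet ω) (n : ℕ) :
    recurrenceDefect (spectralCoeff b z) (fun n => jostApprox c ω δ t s n z) n =
      (phaseError (-mu2 c ω z) t s (n + 1) * (z * (1 + jostCorr c ω δ t (n + 2) z)) +
        phaseError (mu2 c ω z) t s n * (z⁻¹ * (1 + jostCorr c ω δ t n z)) +
        (t (n + 2) - t (n + 1)) * (z * (1 - mu2 c ω z * t (n + 1) ^ 2) *
          (firstCorr c ω δ z (n + 2) + (t (n + 2) + t (n + 1)) * secondCorr c ω δ z (n + 2))) -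
        (t (n + 1) - t n) * (z⁻¹ * (mu2 c ω z * (t n + t (n + 1)) * (1 + jostCorr c ω δ t n z) +
          (1 + mu2 c ω z * t (n + 1) ^ 2) *
            (firstCorr c ω δ z n + (t n + t (n + 1)) * secondCorr c ω δ z n))) +
        q (n + 1) * (1 + jostCorr c ω δ t (n + 1) z) +
        (t (n + 1) : ℂ) ^ 3 *
          (mu2 c ω z * (z⁻¹ * (firstCorr c ω δ z n + t (n + 1) * secondCorr c ω δ z n) -
            z * (firstCorr c ω δ z (n + 2) + t (n + 1) * secondCorr c ω δ z (n + 2))) +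
          ((c * Real.sin (2 * ω * (n + 1 : ℕ) + δ) : ℝ) : ℂ) * secondCorr c ω δ z (n + 1))) *
          jostPhase c ω s (n + 1) z := by
  rw [recurrenceDefect_jostApprox (ne_zero_of_mem_regularSet hz), hb, mul_comm]
  congr 1
  refine Eq.trans ?_ (ansatz_defect_expansion (firstCorr_recurrence hω hz n)
    (secondCorr_recurrence hω hz n))
  simp only [jostCorr, phaseError]
  push_cast
  ring

lemma isBigO_sin_source (l : Filter (ℕ × ℂ)) :
    (fun p : ℕ × ℂ => ((c * Real.sin (2 * ω * (p.1 + 1 : ℕ) + δ) : ℝ) : ℂ))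
      =O[l] fun _ => (1 : ℝ) :=
  .of_bound |c| (.of_forall fun p => by
    rw [Complex.norm_real, norm_mul, norm_one, mul_one]
    exact mul_le_of_le_one_right (abs_nonneg c) (Real.abs_sin_le_one _))

lemma isBigO_amplitude (he : Summable (errorTerm t s q)) (k : ℕ) (l : Filter ℂ) :
    (fun p : ℕ × ℂ => (t (p.1 + k) : ℂ)) =O[atTop ×ˢ l] fun _ => (1 : ℝ) :=
  Complex.isBigO_ofReal_left.mpr
    (((tendsto_amplitude he).comp ((tendsto_add_atTop_nat k).comp tendsto_fst)).isBigO_one ℝ)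

lemma tendsto_jostCorr (he : Summable (errorTerm t s q)) (hω : freq ω ^ 2 ≠ 1)
    (hz : z₀ ∈ regularSet ω) (k : ℕ) :
    Tendsto (fun p : ℕ × ℂ => jostCorr c ω δ t (p.1 + k) p.2) (atTop ×ˢ 𝓝 z₀) (𝓝 0) := by
  have ht : (fun p : ℕ × ℂ => (t (p.1 + k) : ℂ)) =o[atTop ×ˢ 𝓝 z₀] fun _ => (1 : ℝ) :=
    Complex.isLittleO_ofReal_left.mpr <| (isLittleO_one_iff ℝ).mpr <|
      (tendsto_amplitude he).comp ((tendsto_add_atTop_nat k).comp tendsto_fst)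
  have hfirst : (fun p : ℕ × ℂ => t (p.1 + k) * firstCorr c ω δ p.2 (p.1 + k))
      =o[atTop ×ˢ 𝓝 z₀] fun _ => (1 : ℝ) := by
    simpa using ht.mul_isBigO (isBigO_firstCorr c δ hω hz k)
  have hsecond : (fun p : ℕ × ℂ => (t (p.1 + k) : ℂ) ^ 2 * secondCorr c ω δ p.2 (p.1 + k))
      =o[atTop ×ˢ 𝓝 z₀] fun _ => (1 : ℝ) := by
    simpa using (ht.pow two_pos).mul_isBigO (isBigO_secondCorr c δ hω hz k)
  exact (isLittleO_one_iff ℝ).mp (hfirst.add hsecond)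

lemma isBigO_jostCorr (he : Summable (errorTerm t s q)) (hω : freq ω ^ 2 ≠ 1)
    (hz : z₀ ∈ regularSet ω) (k : ℕ) :
    (fun p : ℕ × ℂ => jostCorr c ω δ t (p.1 + k) p.2) =O[atTop ×ˢ 𝓝 z₀] fun _ => (1 : ℝ) :=
  (tendsto_jostCorr he hω hz k).isBigO_one ℝ

lemma isBigO_jostApprox (c δ : ℝ) (he : Summable (errorTerm t s q)) (hω : freq ω ^ 2 ≠ 1)
    (hz : z₀ ∈ regularSet ω) (k : ℕ) :
    (fun p : ℕ × ℂ => jostApprox c ω δ t s (p.1 + k) p.2)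
      =O[atTop ×ˢ 𝓝 z₀] fun p => ‖jostPhase c ω s (p.1 + k) p.2‖ := by
  have hcorr : (fun p : ℕ × ℂ => 1 + jostCorr c ω δ t (p.1 + k) p.2)
      =O[atTop ×ˢ 𝓝 z₀] fun _ => (1 : ℝ) :=
    (isBigO_const_one ℝ 1 _).add (isBigO_jostCorr he hω hz k)
  simpa only [jostApprox, mul_one] using (isBigO_norm_right.mpr (isBigO_refl
    (fun p : ℕ × ℂ => jostPhase c ω s (p.1 + k) p.2) (atTop ×ˢ 𝓝 z₀))).mul hcorr

lemma isBigO_amplitude_step {l : Filter (ℕ × ℂ)} :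
    (fun p : ℕ × ℂ => (t (p.1 + 1) : ℂ) - t p.1) =O[l] fun p => errorTerm t s q p.1 :=
  .of_norm_le fun p => by
    rw [← Complex.ofReal_sub, Complex.norm_real]
    exact abs_amplitude_step_le_errorTerm p.1

lemma isBigO_perturbation {l : Filter (ℕ × ℂ)} :
    (fun p : ℕ × ℂ => (q p.1 : ℂ)) =O[l] fun p => errorTerm t s q p.1 :=
  .of_norm_le fun p => by
    rw [Complex.norm_real]
    exact abs_perturbation_le_errorTerm p.1

lemma isBigO_amplitude_cube {l : Filter (ℕ × ℂ)} :
    (fun p : ℕ × ℂ => (t p.1 : ℂ) ^ 3) =O[l] fun p => errorTerm t s q p.1 :=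
  .of_norm_le fun p => by
    rw [norm_pow, Complex.norm_real]
    exact abs_amplitude_cube_le_errorTerm p.1

lemma isBigO_recurrenceDefect_jostApprox (he : Summable (errorTerm t s q))
    (hω : freq ω ^ 2 ≠ 1)
    (hb : ∀ n, b (n + 1) = c * t (n + 1) * Real.sin (2 * ω * (n + 1 : ℕ) + δ) + q (n + 1))
    (hz : z₀ ∈ regularSet ω) :
    (fun p : ℕ × ℂ => recurrenceDefect (spectralCoeff b p.2)
        (fun n => jostApprox c ω δ t s n p.2) p.1)
      =O[atTop ×ˢ 𝓝 z₀] fun p => errorBound t s q p.1 * ‖jostPhase c ω s (p.1 + 1) p.2‖ := by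
  set l : Filter (ℕ × ℂ) := atTop ×ˢ 𝓝 z₀
  have mul {f g : ℕ × ℂ → ℂ} {ρ : ℕ × ℂ → ℝ} (hf : f =O[l] ρ) (hg : g =O[l] fun _ => (1 : ℝ)) :
      (fun p => f p * g p) =O[l] ρ := isBigO_mul_of_isBigO_one hf hg
  have hmu : ContinuousAt (mu2 c ω) z₀ := (analyticAt_mu2 hz).continuousAt
  have one : (fun _ : ℕ × ℂ => (1 : ℂ)) =O[l] fun _ => (1 : ℝ) := isBigO_const_one ℝ 1 l
  have hid : (fun p : ℕ × ℂ => p.2) =O[l] fun _ => (1 : ℝ) :=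
    isBigO_one_of_continuousAt atTop continuousAt_id
  have hinv : (fun p : ℕ × ℂ => p.2⁻¹) =O[l] fun _ => (1 : ℝ) :=
    isBigO_one_of_continuousAt atTop (continuousAt_inv₀ (ne_zero_of_mem_regularSet hz))
  have hμ : (fun p : ℕ × ℂ => mu2 c ω p.2) =O[l] fun _ => (1 : ℝ) :=
    isBigO_one_of_continuousAt atTop hmu
  have ht (k : ℕ) := isBigO_amplitude he k (𝓝 z₀)
  have hμt : (fun p : ℕ × ℂ => mu2 c ω p.2 * (t (p.1 + 1) : ℂ) ^ 2) =O[l] fun _ => (1 : ℝ) :=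
    mul hμ (by simpa using (ht 1).pow 2)
  have hg (k : ℕ) := isBigO_firstCorr c δ hω hz k
  have hh (k : ℕ) := isBigO_secondCorr c δ hω hz k
  have hu (k : ℕ) := one.add (isBigO_jostCorr (c := c) (δ := δ) he hω hz k)
  have hphase₂ := mul (isBigO_errorBound_succ (isBigO_phaseError he hmu.neg)) (mul hid (hu 2))
  have hphase₀ := mul (isBigO_errorBound (isBigO_phaseError he hmu)) (mul hinv (hu 0))
  have hstep₂ := mul (isBigO_errorBound_succ (isBigO_amplitude_step (t := t) (s := s) (q := q)))
    (mul (mul hid (one.sub hμt)) ((hg 2).add (mul ((ht 2).add (ht 1)) (hh 2))))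
  have hstep₀ := mul (isBigO_errorBound (isBigO_amplitude_step (t := t) (s := s) (q := q)))
    (mul hinv ((mul (mul hμ ((ht 0).add (ht 1))) (hu 0)).add
      (mul (one.add hμt) ((hg 0).add (mul ((ht 0).add (ht 1)) (hh 0))))))
  have hpert := mul (isBigO_errorBound_succ (isBigO_perturbation (t := t) (s := s) (q := q))) (hu 1)
  have hcube := mul (isBigO_errorBound_succ (isBigO_amplitude_cube (t := t) (s := s) (q := q)))
    (mul hμ ((mul hinv ((hg 0).add (mul (ht 1) (hh 0)))).sub
      (mul hid ((hg 2).add (mul (ht 1) (hh 2))))) |>.add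
        (mul (isBigO_sin_source (c := c) (ω := ω) (δ := δ) l) (hh 1)))
  have hphase : (fun p : ℕ × ℂ => jostPhase c ω s (p.1 + 1) p.2) =O[l]
      fun p => ‖jostPhase c ω s (p.1 + 1) p.2‖ := isBigO_norm_right.mpr (isBigO_refl _ _)
  refine ((((((hphase₂.add hphase₀).add hstep₂).sub hstep₀).add hpert).add hcube).mul
    hphase).congr' ?_ .rfl
  filter_upwards [tendsto_snd.eventually ((isOpen_regularSet ω).mem_nhds hz)] with p hp
  exact (recurrenceDefect_jostApprox_eq_errorTerms hω hb hp p.1).symm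

end Ansatz

/-- The discrete Wronskian, which is constant when `u` and `v` solve the same three-term
recurrence. -/
def wronskian {R : Type*} [CommRing R] (u v : ℕ → R) (n : ℕ) : R :=
  u (n + 1) * v n - u n * v (n + 1)

section Wronskian

variable {R : Type*} [CommRing R] {lam u v φ ψ : ℕ → R}

lemma wronskian_succ (hu : ∀ n, recurrenceDefect lam u n = 0) (n : ℕ) :
    wronskian u v (n + 1) = wronskian u v n - u (n + 1) * recurrenceDefect lam v n := by
  have h := hu n
  unfold recurrenceDefect wronskian at *
  linear_combination v (n + 1) * h

lemma mul_wronskian (u φ ψ : ℕ → R) (n : ℕ) : u (n + 1) * wronskian φ ψ n =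
    wronskian u ψ n * φ (n + 1) - wronskian u φ n * ψ (n + 1) := by
  unfold wronskian
  ring

end Wronskian

/-- At the index `n`, the sequences `ψ` and `φ` are approximate solutions of sizes `θ` and `θ⁻¹`
of the recurrence with coefficients `lam`, with relative defect `ρ`; they are quantitatively
independent, and `θ` is nonincreasing. A single constant `C` serves all the estimates. -/
structure IsApproxSolutionPairAt {𝕜 : Type*} [NormedField 𝕜] (lam ψ φ : ℕ → 𝕜) (θ ρ : ℕ → ℝ)
    (C : ℝ) (n : ℕ) : Prop where
  pos : 0 < θ (n + 1)
  succ_le : θ (n + 1) ≤ θ n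
  norm_decaying_le : ‖ψ (n + 1)‖ ≤ C * θ (n + 1)
  norm_growing_le : ‖φ (n + 1)‖ ≤ C * (θ (n + 1))⁻¹
  norm_defect_decaying_le : ‖recurrenceDefect lam ψ n‖ ≤ C * ρ n * θ (n + 1)
  norm_defect_growing_le : ‖recurrenceDefect lam φ n‖ ≤ C * ρ n * (θ (n + 1))⁻¹
  one_le_norm_wronskian : 1 ≤ C * ‖wronskian φ ψ n‖

/-- The size of a solution `u` measured by its Wronskians with the approximate solutions `ψ` of
size `θ` and `φ` of size `θ⁻¹`, weighted so that it controls `θ |u|`. -/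
noncomputable def wronskianSize {𝕜 : Type*} [NormedField 𝕜] (ψ φ : ℕ → 𝕜) (θ : ℕ → ℝ)
    (u : ℕ → 𝕜) (n : ℕ) : ℝ :=
  ‖wronskian u ψ n‖ + θ n ^ 2 * ‖wronskian u φ n‖

section ApproxSolutions

variable {𝕜 : Type*} [NormedField 𝕜] {lam ψ φ u : ℕ → 𝕜} {θ ρ : ℕ → ℝ} {C : ℝ} {n N : ℕ}

lemma wronskianSize_nonneg : 0 ≤ wronskianSize ψ φ θ u n := by
  unfold wronskianSize
  positivity

namespace IsApproxSolutionPairAt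

lemma const_pos (h : IsApproxSolutionPairAt lam ψ φ θ ρ C n) : 0 < C :=
  pos_of_mul_pos_left (one_pos.trans_le h.one_le_norm_wronskian) (norm_nonneg _)

lemma norm_mul_le (h : IsApproxSolutionPairAt lam ψ φ θ ρ C n) (u : ℕ → 𝕜) :
    ‖u (n + 1)‖ * θ (n + 1) ≤ C ^ 2 * wronskianSize ψ φ θ u n := by
  have hC := h.const_pos
  have hθ := h.pos
  have hu : ‖u (n + 1)‖ * ‖wronskian φ ψ n‖ ≤
      C * (‖wronskian u ψ n‖ * (θ (n + 1))⁻¹ + ‖wronskian u φ n‖ * θ (n + 1)) :=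
    calc ‖u (n + 1)‖ * ‖wronskian φ ψ n‖
        = ‖wronskian u ψ n * φ (n + 1) - wronskian u φ n * ψ (n + 1)‖ := by
          rw [← norm_mul, mul_wronskian]
      _ ≤ ‖wronskian u ψ n‖ * ‖φ (n + 1)‖ + ‖wronskian u φ n‖ * ‖ψ (n + 1)‖ := by
          simpa only [norm_mul] using
            norm_sub_le (wronskian u ψ n * φ (n + 1)) (wronskian u φ n * ψ (n + 1))
      _ ≤ ‖wronskian u ψ n‖ * (C * (θ (n + 1))⁻¹) + ‖wronskian u φ n‖ * (C * θ (n + 1)) := by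
          gcongr
          exacts [h.norm_growing_le, h.norm_decaying_le]
      _ = _ := by ring
  calc ‖u (n + 1)‖ * θ (n + 1) ≤ ‖u (n + 1)‖ * θ (n + 1) * (C * ‖wronskian φ ψ n‖) :=
        le_mul_of_one_le_right (by positivity) h.one_le_norm_wronskian
    _ = C * θ (n + 1) * (‖u (n + 1)‖ * ‖wronskian φ ψ n‖) := by ring
    _ ≤ C * θ (n + 1) *
        (C * (‖wronskian u ψ n‖ * (θ (n + 1))⁻¹ + ‖wronskian u φ n‖ * θ (n + 1))) := by gcongr
    _ = C ^ 2 * (‖wronskian u ψ n‖ + θ (n + 1) ^ 2 * ‖wronskian u φ n‖) := by field_simp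
    _ ≤ C ^ 2 * wronskianSize ψ φ θ u n := by
        have := h.succ_le
        unfold wronskianSize
        gcongr

lemma wronskianSize_succ_le (h : IsApproxSolutionPairAt lam ψ φ θ ρ C n)
    (hu : ∀ n, recurrenceDefect lam u n = 0) (hρ : 0 ≤ ρ n) :
    wronskianSize ψ φ θ u (n + 1) ≤ (1 + 2 * C ^ 3 * ρ n) * wronskianSize ψ φ θ u n := by
  have hC := h.const_pos
  have hθ := h.pos
  have step {v : ℕ → 𝕜} {η : ℝ} (hv : ‖recurrenceDefect lam v n‖ ≤ C * ρ n * η) :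
      ‖wronskian u v (n + 1)‖ ≤ ‖wronskian u v n‖ + ‖u (n + 1)‖ * (C * ρ n * η) := by
    rw [wronskian_succ hu]
    refine (norm_sub_le _ _).trans ?_
    rw [norm_mul]
    gcongr
  calc wronskianSize ψ φ θ u (n + 1)
      ≤ (‖wronskian u ψ n‖ + ‖u (n + 1)‖ * (C * ρ n * θ (n + 1))) + θ (n + 1) ^ 2 *
          (‖wronskian u φ n‖ + ‖u (n + 1)‖ * (C * ρ n * (θ (n + 1))⁻¹)) := by
        unfold wronskianSize
        gcongr
        exacts [step h.norm_defect_decaying_le, step h.norm_defect_growing_le]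
    _ = (‖wronskian u ψ n‖ + θ (n + 1) ^ 2 * ‖wronskian u φ n‖) +
          2 * C * ρ n * (‖u (n + 1)‖ * θ (n + 1)) := by field_simp; ring
    _ ≤ wronskianSize ψ φ θ u n + 2 * C * ρ n * (C ^ 2 * wronskianSize ψ φ θ u n) := by
        have := h.succ_le
        refine add_le_add ?_ (mul_le_mul_of_nonneg_left (h.norm_mul_le u) (by positivity))
        unfold wronskianSize
        gcongr
    _ = _ := by ring

end IsApproxSolutionPairAt

lemma norm_mul_le_of_isApproxSolutionPairAt (hρ0 : ∀ n, 0 ≤ ρ n) (hρ : Summable ρ)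
    (h : ∀ n ≥ N, IsApproxSolutionPairAt lam ψ φ θ ρ C n)
    (hu : ∀ n, recurrenceDefect lam u n = 0) (hn : N ≤ n) :
    ‖u (n + 1)‖ * θ (n + 1) ≤
      C ^ 2 * (wronskianSize ψ φ θ u N * Real.exp (2 * C ^ 3 * ∑' k, ρ k)) := by
  have hC := (h N le_rfl).const_pos
  refine ((h n hn).norm_mul_le u).trans ?_
  gcongr
  have hgronwall := discrete_gronwall (c := fun k => 2 * C ^ 3 * ρ k) (b := 0)
    (u := wronskianSize ψ φ θ u) wronskianSize_nonneg
    (fun k hk => by simpa using (h k hk).wronskianSize_succ_le hu (hρ0 k))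
    (fun k _ => by have := hρ0 k; positivity) (fun _ _ => le_rfl) hn
  simp only [Pi.zero_apply, Finset.sum_const_zero, add_zero, ← Finset.mul_sum] at hgronwall
  refine hgronwall.trans ?_
  gcongr
  · exact wronskianSize_nonneg
  · exact hρ.sum_le_tsum _ fun k _ => hρ0 k

end ApproxSolutions

/-- The polynomials `P_n (z + 1/z)` in the uniformizing variable `z`. -/
noncomputable def jostPoly (b : ℕ → ℝ) (n : ℕ) (z : ℂ) : ℂ := orthoPolyEval b n (z + 1 / z)

section GrowthBound

variable {c ω δ : ℝ} {t s q b : ℕ → ℝ} {n : ℕ} {z z₀ : ℂ}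

lemma recurrenceDefect_jostPoly (b : ℕ → ℝ) (z : ℂ) (n : ℕ) :
    recurrenceDefect (spectralCoeff b z) (fun n => jostPoly b n z) n = 0 := by
  simp only [recurrenceDefect, spectralCoeff, jostPoly, orthoPolyEval, orthoPoly, map_sub, map_mul,
    Polynomial.aeval_X, Polynomial.aeval_C, Complex.coe_algebraMap, one_div]
  ring

lemma spectralCoeff_inv (b : ℕ → ℝ) (z : ℂ) : spectralCoeff b z⁻¹ = spectralCoeff b z := by
  unfold spectralCoeff
  rw [inv_inv, add_comm]

lemma analyticAt_jostPoly (b : ℕ → ℝ) (n : ℕ) (hz : z ≠ 0) : AnalyticAt ℂ (jostPoly b n) z := by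
  unfold jostPoly orthoPolyEval
  exact AnalyticAt.aeval_polynomial (by fun_prop (disch := assumption)) _

lemma analyticAt_jostPhase (c : ℝ) (s : ℕ → ℝ) (hz : z ∈ regularSet ω) (n : ℕ) :
    AnalyticAt ℂ (jostPhase c ω s n) z :=
  (analyticAt_id.pow n).mul ((analyticAt_mu2 hz).mul analyticAt_const).neg.cexp

lemma analyticAt_jostApprox (c δ : ℝ) (t s : ℕ → ℝ) (hω : freq ω ^ 2 ≠ 1)
    (hz : z ∈ regularSet ω) (n : ℕ) : AnalyticAt ℂ (jostApprox c ω δ t s n) z :=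
  (analyticAt_jostPhase c s hz n).mul <| analyticAt_const.add <|
    (analyticAt_const.mul (analyticAt_firstCorr c δ hω hz n)).add
      (analyticAt_const.mul (analyticAt_secondCorr c δ hω hz n))

lemma tendsto_prodMk_inv (hz₀ : z₀ ≠ 0) :
    Tendsto (fun p : ℕ × ℂ => (p.1, p.2⁻¹)) (atTop ×ˢ 𝓝 z₀) (atTop ×ˢ 𝓝 z₀⁻¹) :=
  tendsto_id.prodMap (tendsto_inv₀ hz₀)

lemma tendsto_jostPhase_ratio (he : Summable (errorTerm t s q)) (hz : z₀ ∈ regularSet ω) :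
    Tendsto (fun p : ℕ × ℂ =>
        p.2 * Complex.exp (-mu2 c ω p.2 * ((s (p.1 + 1) - s p.1 : ℝ) : ℂ)))
      (atTop ×ˢ 𝓝 z₀) (𝓝 z₀) := by
  have hmu : Tendsto (fun p : ℕ × ℂ => mu2 c ω p.2) (atTop ×ˢ 𝓝 z₀) (𝓝 (mu2 c ω z₀)) :=
    (analyticAt_mu2 hz).continuousAt.tendsto.comp tendsto_snd
  have hs : Tendsto (fun p : ℕ × ℂ => ((s (p.1 + 1) - s p.1 : ℝ) : ℂ)) (atTop ×ˢ 𝓝 z₀)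
      (𝓝 ((0 : ℝ) : ℂ)) :=
    (Complex.continuous_ofReal.tendsto 0).comp ((tendsto_phase_step he).comp tendsto_fst)
  simpa using tendsto_snd.mul (hmu.neg.mul hs).cexp

/- On the circle the decay of `|z|ⁿ` degenerates; it still dominates the factor
`exp (-μ₂ s_n)`, as `Re μ₂` vanishes on the circle. -/
lemma eventually_norm_jostPhase_succ_le (he : Summable (errorTerm t s q))
    (hz : z₀ ∈ regularSet ω) (hz1 : ‖z₀‖ ≤ 1) :
    ∀ᶠ p : ℕ × ℂ in atTop ×ˢ 𝓝[Metric.closedBall 0 1] z₀,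
      ‖jostPhase c ω s (p.1 + 1) p.2‖ ≤ ‖jostPhase c ω s p.1 p.2‖ := by
  suffices h : ∀ᶠ p : ℕ × ℂ in atTop ×ˢ 𝓝[Metric.closedBall 0 1] z₀,
      ‖p.2 * Complex.exp (-mu2 c ω p.2 * ((s (p.1 + 1) - s p.1 : ℝ) : ℂ))‖ ≤ 1 by
    filter_upwards [h] with p hp
    rw [jostPhase_succ, norm_mul]
    exact mul_le_of_le_one_right (norm_nonneg _) hp
  rcases hz1.lt_or_eq with hlt | heq
  · exact ((tendsto_jostPhase_ratio he hz).norm.eventually_le_const hlt).filter_mono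
      (prod_mono_right _ nhdsWithin_le_nhds)
  obtain ⟨K, hK⟩ := exists_abs_re_mu2_le (c := c) hz heq
  have hs : ∀ᶠ n in atTop, K * |s (n + 1) - s n| ≤ 1 := by
    have := (tendsto_phase_step he).abs.const_mul K
    exact this.eventually_le_const (by simp)
  filter_upwards [tendsto_fst.eventually hs, tendsto_snd.eventually
    ((hK.filter_mono nhdsWithin_le_nhds).and self_mem_nhdsWithin)] with ⟨n, z⟩ hn ⟨hmu, hball⟩
  have hz : ‖z‖ ≤ 1 := by simpa using hball
  rw [abs_of_nonneg (sub_nonneg.mpr hz)] at hmu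
  have hexponent : -(mu2 c ω z).re * (s (n + 1) - s n) ≤ 1 - ‖z‖ :=
    calc -(mu2 c ω z).re * (s (n + 1) - s n) ≤ |(mu2 c ω z).re| * |s (n + 1) - s n| := by
          rw [← abs_neg (mu2 c ω z).re, ← abs_mul]; exact le_abs_self _
      _ ≤ K * (1 - ‖z‖) * |s (n + 1) - s n| := by gcongr
      _ = K * |s (n + 1) - s n| * (1 - ‖z‖) := by ring
      _ ≤ 1 - ‖z‖ := mul_le_of_le_one_left (sub_nonneg.mpr hz) hn
  calc ‖z * Complex.exp (-mu2 c ω z * ((s (n + 1) - s n : ℝ) : ℂ))‖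
      = ‖z‖ * Real.exp (-(mu2 c ω z).re * (s (n + 1) - s n)) := by
        rw [norm_mul, Complex.norm_exp, Complex.re_mul_ofReal, Complex.neg_re]
    _ ≤ Real.exp (‖z‖ - 1) * Real.exp (1 - ‖z‖) := by
        gcongr
        linarith [Real.add_one_le_exp (‖z‖ - 1)]
    _ = 1 := by rw [← Real.exp_add]; simp

lemma wronskian_jostApprox_inv (hz : z ≠ 0) :
    wronskian (fun n => jostApprox c ω δ t s n z⁻¹) (fun n => jostApprox c ω δ t s n z) n =
      (z * Complex.exp (-mu2 c ω z * ((s (n + 1) - s n : ℝ) : ℂ)))⁻¹ *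
          ((1 + jostCorr c ω δ t (n + 1) z⁻¹) * (1 + jostCorr c ω δ t n z)) -
        z * Complex.exp (-mu2 c ω z * ((s (n + 1) - s n : ℝ) : ℂ)) *
          ((1 + jostCorr c ω δ t n z⁻¹) * (1 + jostCorr c ω δ t (n + 1) z)) := by
  have hθ : jostPhase c ω s n z ≠ 0 := jostPhase_ne_zero hz
  have := Complex.exp_ne_zero (-mu2 c ω z * ((s (n + 1) - s n : ℝ) : ℂ))
  simp only [wronskian, jostApprox, jostPhase_inv hz, jostPhase_succ]
  field_simp

lemma tendsto_wronskian_jostApprox_inv (he : Summable (errorTerm t s q)) (hω : freq ω ^ 2 ≠ 1)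
    (hz : z₀ ∈ regularSet ω) :
    Tendsto (fun p : ℕ × ℂ => wronskian (fun n => jostApprox c ω δ t s n p.2⁻¹)
      (fun n => jostApprox c ω δ t s n p.2) p.1) (atTop ×ˢ 𝓝 z₀) (𝓝 (z₀⁻¹ - z₀)) := by
  have h0 := ne_zero_of_mem_regularSet hz
  have hratio := tendsto_jostPhase_ratio (c := c) he hz
  have hu (k : ℕ) := (tendsto_jostCorr (c := c) (δ := δ) he hω hz k).const_add 1
  have hv (k : ℕ) := ((tendsto_jostCorr (c := c) (δ := δ) he hω (inv_mem_regularSet hz) k).comp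
    (tendsto_prodMk_inv h0)).const_add 1
  have hlim := ((hratio.inv₀ h0).mul ((hv 1).mul (hu 0))).sub (hratio.mul ((hv 0).mul (hu 1)))
  simp only [add_zero, mul_one] at hlim
  refine hlim.congr' ?_
  filter_upwards [tendsto_snd.eventually (eventually_ne_nhds h0)] with p hp
  exact (wronskian_jostApprox_inv hp).symm

lemma isBigO_one_wronskian_jostApprox_inv (he : Summable (errorTerm t s q))
    (hω : freq ω ^ 2 ≠ 1) (hz : z₀ ∈ regularSet ω) :
    (fun _ : ℕ × ℂ => (1 : ℝ)) =O[atTop ×ˢ 𝓝 z₀] fun p =>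
      wronskian (fun n => jostApprox c ω δ t s n p.2⁻¹)
        (fun n => jostApprox c ω δ t s n p.2) p.1 := by
  have hne : z₀⁻¹ - z₀ ≠ 0 := fun h => sq_ne_one_of_mem_regularSet hz <| by
    rw [sq]
    nth_rw 1 [← sub_eq_zero.mp h]
    exact inv_mul_cancel₀ (ne_zero_of_mem_regularSet hz)
  exact (isBigO_const_const (1 : ℝ) hne _).trans <|
    ((isEquivalent_const_iff_tendsto hne).mpr
      (tendsto_wronskian_jostApprox_inv (c := c) (δ := δ) he hω hz)).isBigO_symm

lemma exists_isApproxSolutionPairAt (he : Summable (errorTerm t s q)) (hω : freq ω ^ 2 ≠ 1)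
    (hb : ∀ n, b (n + 1) = c * t (n + 1) * Real.sin (2 * ω * (n + 1 : ℕ) + δ) + q (n + 1))
    (hz : z₀ ∈ regularSet ω) (hz1 : ‖z₀‖ ≤ 1) :
    ∃ C, ∀ᶠ p : ℕ × ℂ in atTop ×ˢ 𝓝[Metric.closedBall 0 1] z₀,
      IsApproxSolutionPairAt (spectralCoeff b p.2) (fun n => jostApprox c ω δ t s n p.2)
        (fun n => jostApprox c ω δ t s n p.2⁻¹) (fun n => ‖jostPhase c ω s n p.2‖)
        (errorBound t s q) C p.1 := by
  have h0 := ne_zero_of_mem_regularSet hz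
  have hz' := inv_mem_regularSet hz
  have hinv := tendsto_prodMk_inv h0
  have hdecaying := isBigO_jostApprox c δ he hω hz 1
  have hgrowing := (isBigO_jostApprox c δ he hω hz' 1).comp_tendsto hinv
  have hdefect := isBigO_recurrenceDefect_jostApprox he hω hb hz
  have hdefect' := (isBigO_recurrenceDefect_jostApprox he hω hb hz').comp_tendsto hinv
  have hwronskian := isBigO_one_wronskian_jostApprox_inv (c := c) (δ := δ) he hω hz
  rw [isBigO_iff_eventually] at hdecaying hgrowing hdefect hdefect' hwronskian
  obtain ⟨C, hu, hv, hd, hd', hw⟩ := (hdecaying.and <| hgrowing.and <| hdefect.and <|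
    hdefect'.and hwronskian).exists
  refine ⟨C, ?_⟩
  filter_upwards [eventually_norm_jostPhase_succ_le (c := c) he hz hz1,
    (hu.and <| hv.and <| hd.and <| hd'.and <| hw.and <| tendsto_snd.eventually <|
      eventually_ne_nhds h0).filter_mono (prod_mono_right _ nhdsWithin_le_nhds)]
    with ⟨n, z⟩ hmono ⟨hu, hv, hd, hd', hw, hz⟩
  simp only [Function.comp_apply, jostPhase_inv hz, norm_mul, norm_norm, norm_inv, norm_one,
    spectralCoeff_inv, Real.norm_of_nonneg (errorBound_nonneg n), ← mul_assoc] at *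
  exact ⟨norm_pos_iff.mpr (jostPhase_ne_zero hz), hmono, hu, hv, hd, hd', hw⟩

lemma analyticAt_wronskian {f g : ℕ → ℂ → ℂ} (hf : ∀ n, AnalyticAt ℂ (f n) z)
    (hg : ∀ n, AnalyticAt ℂ (g n) z) (n : ℕ) :
    AnalyticAt ℂ (fun w => wronskian (fun n => f n w) (fun n => g n w) n) z :=
  ((hf (n + 1)).mul (hg n)).sub ((hf n).mul (hg (n + 1)))

lemma continuousAt_wronskianSize_jostPoly (c δ : ℝ) (t s b : ℕ → ℝ) (hω : freq ω ^ 2 ≠ 1)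
    (hz : z ∈ regularSet ω) (n : ℕ) :
    ContinuousAt (fun w => wronskianSize (fun n => jostApprox c ω δ t s n w)
      (fun n => jostApprox c ω δ t s n w⁻¹) (fun n => ‖jostPhase c ω s n w‖)
      (fun n => jostPoly b n w) n) z := by
  have h0 := ne_zero_of_mem_regularSet hz
  have hpoly (n : ℕ) := analyticAt_jostPoly b n h0
  have happrox (n : ℕ) := analyticAt_jostApprox c δ t s hω hz n
  have happrox' (n : ℕ) : AnalyticAt ℂ (fun w => jostApprox c ω δ t s n w⁻¹) z :=
    (analyticAt_jostApprox c δ t s hω (inv_mem_regularSet hz) n).comp (analyticAt_inv h0)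
  exact (analyticAt_wronskian hpoly happrox n).continuousAt.norm.add
    (((analyticAt_jostPhase c s hz n).continuousAt.norm.pow 2).mul
      (analyticAt_wronskian hpoly happrox' n).continuousAt.norm)

lemma isBigO_jostPoly_mul_jostPhase (he : Summable (errorTerm t s q)) (hω : freq ω ^ 2 ≠ 1)
    (hb : ∀ n, b (n + 1) = c * t (n + 1) * Real.sin (2 * ω * (n + 1 : ℕ) + δ) + q (n + 1))
    (hz : z₀ ∈ regularSet ω) (hz1 : ‖z₀‖ ≤ 1) :
    (fun p : ℕ × ℂ => jostPoly b (p.1 + 1) p.2 * jostPhase c ω s (p.1 + 1) p.2)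
      =O[atTop ×ˢ 𝓝[Metric.closedBall 0 1] z₀] fun _ => (1 : ℝ) := by
  obtain ⟨C, hC⟩ := exists_isApproxSolutionPairAt (δ := δ) he hω hb hz hz1
  obtain ⟨P, hP, Q, hQ, hpair⟩ := eventually_prod_iff.mp hC
  obtain ⟨N, hN⟩ := eventually_atTop.mp hP
  set G : ℂ → ℝ := fun z => wronskianSize (fun n => jostApprox c ω δ t s n z)
    (fun n => jostApprox c ω δ t s n z⁻¹) (fun n => ‖jostPhase c ω s n z‖)
    (fun n => jostPoly b n z) N
  have hG : ContinuousAt G z₀ := continuousAt_wronskianSize_jostPoly c δ t s b hω hz N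
  have hGle : ∀ᶠ z in 𝓝[Metric.closedBall 0 1] z₀, G z ≤ G z₀ + 1 :=
    (hG.tendsto.eventually_le_const (lt_add_one _)).filter_mono nhdsWithin_le_nhds
  refine .of_bound (C ^ 2 * ((G z₀ + 1) * Real.exp (2 * C ^ 3 * ∑' k, errorBound t s q k))) ?_
  filter_upwards [tendsto_fst.eventually (eventually_ge_atTop N),
    tendsto_snd.eventually (hQ.and hGle)] with ⟨n, z⟩ hn ⟨hQz, hGz⟩
  have hpair_z (m : ℕ) (hm : N ≤ m) : IsApproxSolutionPairAt (spectralCoeff b z)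
      (fun n => jostApprox c ω δ t s n z) (fun n => jostApprox c ω δ t s n z⁻¹)
      (fun n => ‖jostPhase c ω s n z‖) (errorBound t s q) C m := hpair (hN m hm) hQz
  rw [norm_mul, norm_one, mul_one]
  refine (norm_mul_le_of_isApproxSolutionPairAt errorBound_nonneg (summable_errorBound he)
    hpair_z (recurrenceDefect_jostPoly b z) hn).trans ?_
  gcongr

end GrowthBound

section SuccessiveDifferences

variable {X E : Type*} [TopologicalSpace X] [NormedAddCommGroup E] [CompleteSpace E]
  {f : ℕ → X → E} {ρ : ℕ → ℝ} {S : Set X}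

lemma tendstoLocallyUniformlyOn_limUnder_of_isBigO_sub (hρ : Summable ρ)
    (hf : ∀ x ∈ S, (fun p : ℕ × X => f (p.1 + 1) p.2 - f p.1 p.2)
      =O[atTop ×ˢ 𝓝[S] x] fun p => ρ p.1) :
    TendstoLocallyUniformlyOn f (fun x => limUnder atTop fun n => f n x) atTop S := by
  refine tendstoLocallyUniformlyOn_of_forall_exists_nhds fun x hx => ?_
  obtain ⟨C, hC⟩ := (hf x hx).bound
  obtain ⟨P, hP, Q, hQ, hbound⟩ := eventually_prod_iff.mp hC
  have hsum := tendstoUniformlyOn_tsum_nat_eventually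
    (f := fun n y => f (n + 1) y - f n y) (s := {y | Q y}) (hρ.norm.mul_left C)
    (hP.mono fun n hn y hy => hbound hn hy)
  have hlim : TendstoUniformlyOn f
      (fun y => f 0 y + ∑' n, (f (n + 1) y - f n y)) atTop {y | Q y} := by
    rw [Metric.tendstoUniformlyOn_iff] at hsum ⊢
    refine fun ε hε => (hsum ε hε).mono fun n hn y hy => ?_
    rw [← sub_add_cancel (f n y) (f 0 y), add_comm, dist_add_right,
      ← Finset.sum_range_sub (fun n => f n y)]
    exact hn y hy
  exact ⟨_, hQ, hlim.congr_right fun y hy => (hlim.tendsto_at hy).limUnder_eq.symm⟩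

end SuccessiveDifferences

lemma tendsto_zero_of_norm_lt_one {𝕜 : Type*} [NormedField 𝕜] {d : ℕ → 𝕜} {a : 𝕜}
    (ha : ‖a‖ < 1) (h : Tendsto (fun n => d (n + 1) - a * d n) atTop (𝓝 0)) :
    Tendsto d atTop (𝓝 0) := by
  refine NormedAddGroup.tendsto_nhds_zero.mpr fun ε hε => ?_
  have hstep : ∀ᶠ n in atTop, ‖d (n + 1) - a * d n‖ < (1 - ‖a‖) * (ε / 2) :=
    NormedAddGroup.tendsto_nhds_zero.mp h _ (mul_pos (sub_pos.mpr ha) (half_pos hε))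
  obtain ⟨N, hN⟩ := eventually_atTop.mp hstep
  have hexcess (n : ℕ) (hn : N ≤ n) : ‖d (n + 1)‖ - ε / 2 ≤ ‖a‖ * (‖d n‖ - ε / 2) := by
    have := norm_sub_norm_le (d (n + 1)) (a * d n)
    rw [norm_mul] at this
    linarith [hN n hn]
  have hgeom (m : ℕ) : ‖d (m + N)‖ - ε / 2 ≤ ‖a‖ ^ m * (‖d N‖ - ε / 2) := by
    simpa using le_geom (u := fun m => ‖d (m + N)‖ - ε / 2) (norm_nonneg a) m fun k _ => by
      simpa only [add_right_comm] using hexcess (k + N) (Nat.le_add_left N k)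
  have hzero : Tendsto (fun m => ‖a‖ ^ m * (‖d N‖ - ε / 2)) atTop (𝓝 0) := by
    simpa using (tendsto_pow_atTop_nhds_zero_of_lt_one (norm_nonneg a) ha).mul_const _
  rw [← map_add_atTop_eq_nat N, eventually_map]
  filter_upwards [hzero.eventually_lt_const (half_pos hε)] with m hm
  linarith [hgeom m]

lemma tendsto_of_tendsto_succ_sub_mul {𝕜 : Type*} [NormedField 𝕜] {d : ℕ → 𝕜} {a L : 𝕜}
    (ha : ‖a‖ < 1) (h : Tendsto (fun n => d (n + 1) - a * d n) atTop (𝓝 L)) :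
    Tendsto d atTop (𝓝 (L / (1 - a))) := by
  have ha1 : 1 - a ≠ 0 := sub_ne_zero.mpr fun h => by simp [← h] at ha
  rw [← tendsto_sub_nhds_zero_iff] at h ⊢
  refine tendsto_zero_of_norm_lt_one ha (h.congr fun n => ?_)
  field_simp
  ring

/-- The Wronskian of the polynomials with the decaying approximate solution. -/
noncomputable def jostWronskian (c ω δ : ℝ) (t s b : ℕ → ℝ) (n : ℕ) (z : ℂ) : ℂ :=
  wronskian (fun n => jostPoly b n z) (fun n => jostApprox c ω δ t s n z) n

/-- The Jost function, as the limit of the Wronskians of the polynomials with the decaying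
approximate solution. -/
noncomputable def jostFunction (c ω δ : ℝ) (t s b : ℕ → ℝ) (z : ℂ) : ℂ :=
  limUnder atTop fun n => jostWronskian c ω δ t s b n z

section JostFunction

variable {c ω δ : ℝ} {t s q b : ℕ → ℝ} {z z₀ : ℂ}

lemma isBigO_jostWronskian_succ_sub (he : Summable (errorTerm t s q)) (hω : freq ω ^ 2 ≠ 1)
    (hb : ∀ n, b (n + 1) = c * t (n + 1) * Real.sin (2 * ω * (n + 1 : ℕ) + δ) + q (n + 1))
    (hz : z₀ ∈ regularSet ω) (hz1 : ‖z₀‖ ≤ 1) :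
    (fun p : ℕ × ℂ =>
        jostWronskian c ω δ t s b (p.1 + 1) p.2 - jostWronskian c ω δ t s b p.1 p.2)
      =O[atTop ×ˢ 𝓝[Metric.closedBall 0 1] z₀] fun p => errorBound t s q p.1 := by
  have hdefect := (isBigO_recurrenceDefect_jostApprox he hω hb hz).mono
    (prod_mono_right atTop (nhdsWithin_le_nhds (s := Metric.closedBall 0 1)))
  have hpoly := isBigO_jostPoly_mul_jostPhase he hω hb hz hz1
  have hprod : (fun p : ℕ × ℂ => jostPoly b (p.1 + 1) p.2 *
      recurrenceDefect (spectralCoeff b p.2) (fun n => jostApprox c ω δ t s n p.2) p.1)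
      =O[atTop ×ˢ 𝓝[Metric.closedBall 0 1] z₀] fun p => errorBound t s q p.1 := by
    refine ((isBigO_refl (fun p : ℕ × ℂ => jostPoly b (p.1 + 1) p.2) _).norm_right.mul
      hdefect).trans ?_
    refine ((hpoly.norm_left.mul (isBigO_refl (fun p => errorBound t s q p.1) _)).congr_left
      fun p => ?_).congr_right fun p => one_mul _
    rw [norm_mul]
    ring
  refine hprod.neg_left.congr_left fun p => ?_
  rw [jostWronskian, jostWronskian, wronskian_succ (recurrenceDefect_jostPoly b p.2)]
  ring

lemma tendstoLocallyUniformlyOn_jostWronskian (he : Summable (errorTerm t s q))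
    (hω : freq ω ^ 2 ≠ 1)
    (hb : ∀ n, b (n + 1) = c * t (n + 1) * Real.sin (2 * ω * (n + 1 : ℕ) + δ) + q (n + 1)) :
    TendstoLocallyUniformlyOn (jostWronskian c ω δ t s b) (jostFunction c ω δ t s b) atTop
      (Metric.closedBall 0 1 ∩ regularSet ω) :=
  tendstoLocallyUniformlyOn_limUnder_of_isBigO_sub (summable_errorBound he) fun _ hz =>
    (isBigO_jostWronskian_succ_sub he hω hb hz.2 (mem_closedBall_zero_iff.mp hz.1)).mono
      (prod_mono_right _ (nhdsWithin_mono _ Set.inter_subset_left))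

lemma analyticAt_jostWronskian (c δ : ℝ) (t s b : ℕ → ℝ) (hω : freq ω ^ 2 ≠ 1)
    (hz : z ∈ regularSet ω) (n : ℕ) : AnalyticAt ℂ (jostWronskian c ω δ t s b n) z :=
  analyticAt_wronskian (fun n => analyticAt_jostPoly b n (ne_zero_of_mem_regularSet hz))
    (fun n => analyticAt_jostApprox c δ t s hω hz n) n

lemma continuousOn_jostFunction (he : Summable (errorTerm t s q)) (hω : freq ω ^ 2 ≠ 1)
    (hb : ∀ n, b (n + 1) = c * t (n + 1) * Real.sin (2 * ω * (n + 1 : ℕ) + δ) + q (n + 1)) :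
    ContinuousOn (jostFunction c ω δ t s b) (Metric.closedBall 0 1 ∩ regularSet ω) :=
  (tendstoLocallyUniformlyOn_jostWronskian he hω hb).continuousOn <| .of_forall fun n _ hz =>
    (analyticAt_jostWronskian c δ t s b hω hz.2 n).continuousAt.continuousWithinAt

lemma analyticOnNhd_jostFunction (he : Summable (errorTerm t s q)) (hω : freq ω ^ 2 ≠ 1)
    (hb : ∀ n, b (n + 1) = c * t (n + 1) * Real.sin (2 * ω * (n + 1 : ℕ) + δ) + q (n + 1)) :
    AnalyticOnNhd ℂ (jostFunction c ω δ t s b) (Metric.ball 0 1 \ {0}) := by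
  have hopen : IsOpen (Metric.ball (0 : ℂ) 1 \ {0}) := Metric.isOpen_ball.sdiff isClosed_singleton
  have hsub : Metric.ball (0 : ℂ) 1 \ {0} ⊆ Metric.closedBall 0 1 ∩ regularSet ω := fun z hz =>
    ⟨Metric.ball_subset_closedBall hz.1,
      mem_regularSet_of_norm_lt_one hz.2 (mem_ball_zero_iff.mp hz.1)⟩
  refine DifferentiableOn.analyticOnNhd ?_ hopen
  exact ((tendstoLocallyUniformlyOn_jostWronskian he hω hb).mono hsub).differentiableOn
    (.of_forall fun n z hz =>
      (analyticAt_jostWronskian c δ t s b hω (hsub hz).2 n).differentiableAt.differentiableWithinAt)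
    hopen

end JostFunction

section Asymptotics

variable {c ω δ : ℝ} {t s q b : ℕ → ℝ} {z : ℂ}

lemma tendsto_prodMk_of_pure_le {ι X : Type*} {l : Filter ι} {m : Filter X} {x : X}
    (hx : pure x ≤ m) : Tendsto (fun i => (i, x)) l (l ×ˢ m) :=
  tendsto_id.prodMk (tendsto_const_pure.mono_right hx)

lemma isBigO_jostPoly_succ_mul_jostPhase (he : Summable (errorTerm t s q))
    (hω : freq ω ^ 2 ≠ 1)
    (hb : ∀ n, b (n + 1) = c * t (n + 1) * Real.sin (2 * ω * (n + 1 : ℕ) + δ) + q (n + 1))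
    (hz : z ∈ regularSet ω) (hz1 : ‖z‖ ≤ 1) :
    (fun n => jostPoly b (n + 1) z * jostPhase c ω s (n + 1) z) =O[atTop] fun _ => (1 : ℝ) :=
  (isBigO_jostPoly_mul_jostPhase he hω hb hz hz1).comp_tendsto
    (tendsto_prodMk_of_pure_le (pure_le_nhdsWithin (mem_closedBall_zero_iff.mpr hz1)))

lemma tendsto_jostPhase_ratio_apply (c : ℝ) (he : Summable (errorTerm t s q))
    (hz : z ∈ regularSet ω) :
    Tendsto (fun n => jostPhase c ω s (n + 1) z / jostPhase c ω s n z) atTop (𝓝 z) :=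
  ((tendsto_jostPhase_ratio he hz).comp (tendsto_prodMk_of_pure_le (pure_le_nhds z))).congr
    fun n => by
      rw [jostPhase_succ, mul_div_cancel_left₀ _ (jostPhase_ne_zero (ne_zero_of_mem_regularSet hz))]
      rfl

lemma tendsto_mul_zero_of_isBigO_one {ι : Type*} {l : Filter ι} {f g : ι → ℂ}
    (hf : f =O[l] fun _ => (1 : ℝ)) (hg : Tendsto g l (𝓝 0)) :
    Tendsto (fun i => f i * g i) l (𝓝 0) := by
  simpa [isLittleO_one_iff] using hf.mul_isLittleO ((isLittleO_one_iff ℝ).mpr hg)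

lemma tendsto_sub_mul_jostPhase (he : Summable (errorTerm t s q)) (hω : freq ω ^ 2 ≠ 1)
    (hb : ∀ n, b (n + 1) = c * t (n + 1) * Real.sin (2 * ω * (n + 1 : ℕ) + δ) + q (n + 1))
    (hz : z ∈ regularSet ω) (hz1 : ‖z‖ ≤ 1) :
    Tendsto (fun n => (jostPoly b (n + 1) z - z * jostPoly b n z) * jostPhase c ω s n z) atTop
      (𝓝 (jostFunction c ω δ t s b z)) := by
  have h0 := ne_zero_of_mem_regularSet hz
  have hp := isBigO_jostPoly_succ_mul_jostPhase he hω hb hz hz1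
  have hp0 : (fun n => jostPoly b n z * jostPhase c ω s n z) =O[atTop] fun _ => (1 : ℝ) := by
    rw [← map_add_atTop_eq_nat 1]
    exact isBigO_map.mpr hp
  have hW := (tendstoLocallyUniformlyOn_jostWronskian he hω hb).tendsto_at
    ⟨mem_closedBall_zero_iff.mpr hz1, hz⟩
  have hr := tendsto_jostPhase_ratio_apply c he hz
  have hu (k : ℕ) : Tendsto (fun n => jostCorr c ω δ t (n + k) z) atTop (𝓝 0) := by
    simpa only [Function.comp_def] using (tendsto_jostCorr (c := c) (δ := δ) he hω hz k).comp
      (tendsto_prodMk_of_pure_le (pure_le_nhds z))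
  have herr : Tendsto (fun n => (jostPhase c ω s (n + 1) z / jostPhase c ω s n z)⁻¹ *
      jostCorr c ω δ t n z) atTop (𝓝 0) := by
    simpa using (hr.inv₀ h0).mul (hu 0)
  have herr' : Tendsto (fun n => jostPhase c ω s (n + 1) z / jostPhase c ω s n z *
      (1 + jostCorr c ω δ t (n + 1) z) - z) atTop (𝓝 0) := by
    simpa using (hr.mul ((hu 1).const_add 1)).sub_const z
  have hlim := (hW.sub (tendsto_mul_zero_of_isBigO_one hp herr)).add
    (tendsto_mul_zero_of_isBigO_one hp0 herr')
  rw [sub_zero, add_zero] at hlim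
  refine hlim.congr fun n => ?_
  have hθ := jostPhase_ne_zero (c := c) (ω := ω) (s := s) (n := n) h0
  have hθ' := jostPhase_ne_zero (c := c) (ω := ω) (s := s) (n := n + 1) h0
  simp only [jostWronskian, wronskian, jostApprox]
  field_simp
  ring

lemma inv_jostPhase (c ω : ℝ) (s : ℕ → ℝ) (n : ℕ) (z : ℂ) :
    (jostPhase c ω s n z)⁻¹ = 1 / z ^ n * Complex.exp (mu2 c ω z * s n) := by
  rw [jostPhase, mul_inv, ← Complex.exp_neg, neg_neg, one_div]

lemma norm_jostPhase (c ω : ℝ) (s : ℕ → ℝ) (n : ℕ) (z : ℂ) :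
    ‖jostPhase c ω s n z‖ = ‖z‖ ^ n * Real.exp (-((mu2 c ω z).re * s n)) := by
  rw [jostPhase, norm_mul, norm_pow, Complex.norm_exp, Complex.neg_re, Complex.re_mul_ofReal]

lemma norm_jostPhase_of_norm_eq_one (hz : ‖z‖ = 1) (n : ℕ) : ‖jostPhase c ω s n z‖ = 1 := by
  simp [norm_jostPhase, re_mu2_of_norm_eq_one hz, hz]

lemma one_sub_sq_ne_zero_of_mem_regularSet (hz : z ∈ regularSet ω) : 1 - z ^ 2 ≠ 0 :=
  sub_ne_zero.mpr (sq_ne_one_of_mem_regularSet hz).symm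

lemma conj_jostPoly (b : ℕ → ℝ) (n : ℕ) (hz : ‖z‖ = 1) :
    (starRingEnd ℂ) (jostPoly b n z) = jostPoly b n z := by
  rw [jostPoly, orthoPolyEval, ← Polynomial.aeval_conj]
  simp only [map_add, map_div₀, map_one]
  rw [← Complex.inv_eq_conj hz, one_div, one_div, inv_inv, add_comm]

lemma tendsto_jostPoly_sub_of_norm_eq_one (he : Summable (errorTerm t s q))
    (hω : freq ω ^ 2 ≠ 1)
    (hb : ∀ n, b (n + 1) = c * t (n + 1) * Real.sin (2 * ω * (n + 1 : ℕ) + δ) + q (n + 1))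
    (hz : z ∈ regularSet ω) (hz1 : ‖z‖ = 1) :
    Tendsto (fun n => jostPoly b n z -
      (z * jostFunction c ω δ t s b z / (1 - z ^ 2) * (jostPhase c ω s n z)⁻¹ +
        z * (starRingEnd ℂ) (jostFunction c ω δ t s b z) / (z ^ 2 - 1) * jostPhase c ω s n z))
      atTop (𝓝 0) := by
  set F := jostFunction c ω δ t s b z
  set θ : ℕ → ℂ := fun n => jostPhase c ω s n z
  have hθ (n : ℕ) : ‖θ n‖ = 1 := norm_jostPhase_of_norm_eq_one hz1 n
  have hθ0 (n : ℕ) : θ n ≠ 0 := jostPhase_ne_zero (ne_zero_of_mem_regularSet hz)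
  have hF : Tendsto (fun n => jostPoly b (n + 1) z - z * jostPoly b n z - F * (θ n)⁻¹)
      atTop (𝓝 0) := by
    have h := tendsto_zero_iff_norm_tendsto_zero.mp (tendsto_sub_nhds_zero_iff.mpr
      (tendsto_sub_mul_jostPhase he hω hb hz hz1.le))
    refine tendsto_zero_iff_norm_tendsto_zero.mpr (h.congr fun n => ?_)
    rw [← mul_one ‖_ - F * _‖, ← hθ n, ← norm_mul, sub_mul _ (F * (θ n)⁻¹),
      inv_mul_cancel_right₀ (hθ0 n)]
  have hconj : Tendsto (fun n => jostPoly b (n + 1) z - z⁻¹ * jostPoly b n z -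
      (starRingEnd ℂ) F * θ n) atTop (𝓝 0) := by
    refine ((Complex.continuous_conj.tendsto' 0 0 (map_zero _)).comp hF).congr fun n => ?_
    simp only [Function.comp_apply, map_sub, map_mul, map_inv₀, conj_jostPoly b _ hz1,
      ← Complex.inv_eq_conj hz1, ← Complex.inv_eq_conj (hθ n), inv_inv]
  have hdiff := (hconj.sub hF).const_mul (-(z / (1 - z ^ 2)))
  rw [sub_zero, mul_zero] at hdiff
  refine hdiff.congr fun n => ?_
  have h0 := ne_zero_of_mem_regularSet hz
  have h1 := one_sub_sq_ne_zero_of_mem_regularSet hz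
  have := hθ0 n
  change _ = jostPoly b n z - (z * F / (1 - z ^ 2) * (θ n)⁻¹ +
    z * (starRingEnd ℂ) F / (z ^ 2 - 1) * θ n)
  rw [← neg_sub 1 (z ^ 2)]
  field_simp
  ring

lemma isLittleO_jostPoly_sub_of_norm_lt_one (he : Summable (errorTerm t s q))
    (hω : freq ω ^ 2 ≠ 1)
    (hb : ∀ n, b (n + 1) = c * t (n + 1) * Real.sin (2 * ω * (n + 1 : ℕ) + δ) + q (n + 1))
    (h0 : z ≠ 0) (hz1 : ‖z‖ < 1) :
    (fun n => jostPoly b n z -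
        z * jostFunction c ω δ t s b z / (1 - z ^ 2) * (jostPhase c ω s n z)⁻¹)
      =o[atTop] fun n => ‖jostPhase c ω s n z‖⁻¹ := by
  have hz := mem_regularSet_of_norm_lt_one (ω := ω) h0 hz1
  have hθ (n : ℕ) := jostPhase_ne_zero (c := c) (ω := ω) (s := s) (n := n) h0
  have hp := isBigO_jostPoly_succ_mul_jostPhase he hω hb hz hz1.le
  have hr := tendsto_jostPhase_ratio_apply c he hz
  have herr : Tendsto (fun n => 1 - z * (jostPhase c ω s (n + 1) z / jostPhase c ω s n z)⁻¹)
      atTop (𝓝 0) := by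
    simpa [h0] using ((hr.inv₀ h0).const_mul z).const_sub 1
  have hsucc : Tendsto (fun n => jostPoly b (n + 1) z * jostPhase c ω s (n + 1) z -
      z ^ 2 * (jostPoly b n z * jostPhase c ω s n z)) atTop
      (𝓝 (z * jostFunction c ω δ t s b z)) := by
    have hlim := ((tendsto_sub_mul_jostPhase he hω hb hz hz1.le).const_mul z).add
      (tendsto_mul_zero_of_isBigO_one hp herr)
    rw [add_zero] at hlim
    refine hlim.congr fun n => ?_
    have := hθ n
    have := hθ (n + 1)
    field_simp
    ring
  have hsq : ‖z ^ 2‖ < 1 := by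
    rw [norm_pow]
    exact pow_lt_one₀ (norm_nonneg z) hz1 two_ne_zero
  have hlim := (isLittleO_one_iff ℝ).mpr (tendsto_sub_nhds_zero_iff.mpr
    (tendsto_of_tendsto_succ_sub_mul
      (d := fun n => jostPoly b n z * jostPhase c ω s n z) hsq hsucc))
  refine ((isBigO_refl (fun n => (jostPhase c ω s n z)⁻¹) atTop).norm_right.mul_isLittleO
    hlim).congr (fun n => ?_) fun n => ?_
  · have := hθ n
    field_simp
  · rw [mul_one, norm_inv]

end Asymptotics

section PowerSequences

lemma summable_abs_succ_sub_of_antitone {u : ℕ → ℝ} (hu : Antitone u)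
    (hu' : BddBelow (Set.range u)) : Summable fun n => |u (n + 1) - u n| := by
  obtain ⟨m, hm⟩ := hu'
  refine summable_of_sum_range_le (c := u 0 - m) (fun n => abs_nonneg _) fun n => ?_
  have hdiff (k : ℕ) : |u (k + 1) - u k| = u k - u (k + 1) := by
    rw [abs_sub_comm, abs_of_nonneg (sub_nonneg.mpr (hu k.le_succ))]
  simp only [hdiff, Finset.sum_range_sub']
  exact sub_le_sub_left (hm (Set.mem_range_self n)) _

lemma summable_abs_rpow_succ_sub_rpow {p : ℝ} (hp : p ≤ 0) :
    Summable fun n : ℕ => |((n + 1 : ℕ) : ℝ) ^ p - (n : ℝ) ^ p| := by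
  rw [← summable_nat_add_iff 1]
  refine summable_abs_succ_sub_of_antitone (u := fun n => ((n + 1 : ℕ) : ℝ) ^ p)
    (fun m n hmn => ?_) ⟨0, ?_⟩
  · exact Real.rpow_le_rpow_of_nonpos (by positivity) (by gcongr) hp
  · rintro _ ⟨n, rfl⟩
    positivity

lemma abs_rpow_div_succ_sub_le {r : ℝ} (hr : r ≠ 0) (hr1 : r ≤ 1) {n : ℕ} (hn : 0 < n) :
    |((n + 1 : ℕ) : ℝ) ^ r / r - (n : ℝ) ^ r / r - (n : ℝ) ^ (r - 1)| ≤
      |((n + 1 : ℕ) : ℝ) ^ (r - 1) - (n : ℝ) ^ (r - 1)| := by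
  have hn0 : (0 : ℝ) < n := Nat.cast_pos.mpr hn
  have hderiv (x : ℝ) (hx : (n : ℝ) ≤ x) :
      HasDerivAt (fun x : ℝ => x ^ r / r) (x ^ (r - 1)) x := by
    simpa only [mul_div_cancel_left₀ _ hr] using
      (Real.hasDerivAt_rpow_const (p := r) (Or.inl (hn0.trans_le hx).ne')).div_const r
  obtain ⟨x, hx, hslope⟩ := exists_hasDerivAt_eq_slope (fun x : ℝ => x ^ r / r)
    (fun x => x ^ (r - 1)) (Nat.cast_lt.mpr n.lt_succ_self)
    (fun x hx => (hderiv x hx.1).continuousAt.continuousWithinAt)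
    (fun x hx => hderiv x hx.1.le)
  rw [Nat.cast_succ, add_sub_cancel_left, div_one, ← Nat.cast_succ] at hslope
  rw [← hslope]
  refine Set.abs_sub_left_of_mem_uIcc (Set.mem_uIcc.mpr (Or.inr ⟨?_, ?_⟩))
  · exact Real.rpow_le_rpow_of_nonpos (hn0.trans hx.1) hx.2.le (sub_nonpos.mpr hr1)
  · exact Real.rpow_le_rpow_of_nonpos hn0 hx.1.le (sub_nonpos.mpr hr1)

lemma summable_abs_rpow_div_succ_sub {r : ℝ} (hr : r ≠ 0) (hr1 : r ≤ 1) :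
    Summable fun n : ℕ =>
      |((n + 1 : ℕ) : ℝ) ^ r / r - (n : ℝ) ^ r / r - (n : ℝ) ^ (r - 1)| := by
  rw [← summable_nat_add_iff 1]
  exact .of_nonneg_of_le (fun n => abs_nonneg _)
    (fun n => abs_rpow_div_succ_sub_le hr hr1 n.succ_pos)
    ((summable_nat_add_iff 1).mpr (summable_abs_rpow_succ_sub_rpow (sub_nonpos.mpr hr1)))

lemma summable_abs_rpow_neg_pow_three {γ : ℝ} (hγ : 1 / 3 < γ) :
    Summable fun n : ℕ => |(n : ℝ) ^ (-γ)| ^ 3 := by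
  simp only [abs_of_nonneg (Real.rpow_nonneg (Nat.cast_nonneg _) _),
    ← Real.rpow_mul_natCast (Nat.cast_nonneg _), Real.summable_nat_rpow]
  push_cast
  linarith

lemma summable_abs_rpow_div_succ_sub_sq {γ : ℝ} (hγ : 0 ≤ γ) (hγ' : γ ≠ 1 / 2) :
    Summable fun n : ℕ => |((n + 1 : ℕ) : ℝ) ^ (1 - 2 * γ) / (1 - 2 * γ) -
      (n : ℝ) ^ (1 - 2 * γ) / (1 - 2 * γ) - ((n : ℝ) ^ (-γ)) ^ 2| := by
  have hr : 1 - 2 * γ ≠ 0 := fun h => hγ' (by linarith)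
  convert summable_abs_rpow_div_succ_sub hr (by linarith) using 4 with n
  rw [← Real.rpow_mul_natCast n.cast_nonneg]
  ring_nf

lemma phaseExponent_eq_mu2_mul (c ω γ : ℝ) (z : ℂ) (n : ℕ) :
    phaseExponent c ω γ z n = mu2 c ω z * ((n : ℝ) ^ (1 - 2 * γ) / (1 - 2 * γ) : ℝ) := by
  rw [phaseExponent, mul_div_assoc]
  push_cast
  rfl

end PowerSequences

theorem theorem5p1_general (c ω δ : ℝ) (t s q b : ℕ → ℝ)
    (hω : ∀ k : ℤ, 2 * ω ≠ Real.pi * k)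
    (hq : Summable fun n : ℕ => |q n|)
    (ht : Summable fun n : ℕ => |t n| ^ 3)
    (hvar : Summable fun n : ℕ => |t (n + 1) - t n|)
    (hs : Summable fun n : ℕ => |s (n + 1) - s n - t n ^ 2|)
    (hb : ∀ n : ℕ, 1 ≤ n → b n = c * t n * Real.sin (2 * ω * n + δ) + q n) :
    ∃ F : ℂ → ℂ,
      (∀ z ∈ Metric.ball (0 : ℂ) 1 \ {0},
        (fun n : ℕ => orthoPolyEval b n (z + 1 / z) -
            z * F z / (1 - z ^ 2) * (1 / z ^ n) * Complex.exp (mu2 c ω z * s n))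
          =o[atTop] fun n : ℕ => 1 / ‖z‖ ^ n * Real.exp ((mu2 c ω z).re * s n)) ∧
      (∀ z ∈ Metric.sphere (0 : ℂ) 1 ∩ regularSet ω,
        (fun n : ℕ => orthoPolyEval b n (z + 1 / z) -
            (z * F z / (1 - z ^ 2) * (1 / z ^ n) * Complex.exp (mu2 c ω z * s n) +
              z * (starRingEnd ℂ) (F z) / (z ^ 2 - 1) * z ^ n *
                Complex.exp (-(mu2 c ω z * s n))))
          =o[atTop] fun _ : ℕ => (1 : ℝ)) ∧
      AnalyticOnNhd ℂ F (Metric.ball (0 : ℂ) 1 \ {0}) ∧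
      ContinuousOn F (Metric.closedBall (0 : ℂ) 1 ∩ regularSet ω) := by
  have he : Summable (errorTerm t s q) := ((hq.add ht).add hvar).add hs
  have hω' := freq_sq_ne_one hω
  have hb' (n : ℕ) := hb (n + 1) n.succ_pos
  refine ⟨jostFunction c ω δ t s b, fun z hz => ?_, fun z hz => ?_,
    analyticOnNhd_jostFunction he hω' hb', continuousOn_jostFunction he hω' hb'⟩
  · refine (isLittleO_jostPoly_sub_of_norm_lt_one he hω' hb' hz.2
      (mem_ball_zero_iff.mp hz.1)).congr (fun n => ?_) fun n => ?_
    · rw [inv_jostPhase, mul_assoc (_ / _), jostPoly]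
    · rw [norm_jostPhase, mul_inv, ← Real.exp_neg, neg_neg, one_div]
  · refine (isLittleO_one_iff ℝ).mpr ((tendsto_jostPoly_sub_of_norm_eq_one he hω' hb' hz.2
      (mem_sphere_zero_iff_norm.mp hz.1)).congr fun n => ?_)
    rw [inv_jostPhase, jostPhase, jostPoly, mul_assoc (_ / _) (1 / _), mul_assoc (_ / _) (z ^ n)]

theorem theorem5p1 (c ω δ γ : ℝ) (q b : ℕ → ℝ)
    (hγ : γ ∈ Set.Ioo (1 / 3 : ℝ) (1 / 2))
    (hω : ∀ k : ℤ, 2 * ω ≠ Real.pi * k)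
    (hq : Summable fun n : ℕ => |q n|)
    (hb : ∀ n : ℕ, 1 ≤ n → b n = c * Real.sin (2 * ω * n + δ) / (n : ℝ) ^ γ + q n) :
    ∃ F : ℂ → ℂ,
      (∀ z ∈ Metric.ball (0 : ℂ) 1 \ {0},
        (fun n : ℕ => orthoPolyEval b n (z + 1 / z) -
            z * F z / (1 - z ^ 2) * (1 / z ^ n) * Complex.exp (phaseExponent c ω γ z n))
          =o[atTop] fun n : ℕ =>
            1 / ‖z‖ ^ n * Real.exp ((mu2 c ω z).re * (n : ℝ) ^ (1 - 2 * γ) / (1 - 2 * γ))) ∧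
      (∀ z ∈ Metric.sphere (0 : ℂ) 1 ∩ regularSet ω,
        (fun n : ℕ => orthoPolyEval b n (z + 1 / z) -
            (z * F z / (1 - z ^ 2) * (1 / z ^ n) * Complex.exp (phaseExponent c ω γ z n) +
              z * (starRingEnd ℂ) (F z) / (z ^ 2 - 1) * z ^ n *
                Complex.exp (-phaseExponent c ω γ z n)))
          =o[atTop] fun _ : ℕ => (1 : ℝ)) ∧
      AnalyticOnNhd ℂ F (Metric.ball (0 : ℂ) 1 \ {0}) ∧
      ContinuousOn F (Metric.closedBall (0 : ℂ) 1 ∩ regularSet ω) := by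
  have hγ0 : 0 < γ := by linarith [hγ.1]
  have hb' (n : ℕ) (hn : 1 ≤ n) :
      b n = c * (n : ℝ) ^ (-γ) * Real.sin (2 * ω * n + δ) + q n := by
    rw [hb n hn, Real.rpow_neg n.cast_nonneg]
    ring
  simpa only [phaseExponent_eq_mu2_mul, mul_div_assoc] using theorem5p1_general c ω δ
    (fun n => (n : ℝ) ^ (-γ)) (fun n => (n : ℝ) ^ (1 - 2 * γ) / (1 - 2 * γ)) q b hω hq
    (summable_abs_rpow_neg_pow_three hγ.1)
    (summable_abs_rpow_succ_sub_rpow (neg_nonpos.mpr hγ0.le))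
    (summable_abs_rpow_div_succ_sub_sq hγ0.le hγ.2.ne) hb'
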